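/- Let $m\ge 2$ and let $q_1,\dots,q_m\in L_2(0,\pi)$ be real-valued. Let $L$ be the boundary value problem on the star-shaped graph with $m$ edges of length $\pi$: $$-y_j''+q_jy_j=\lambda y_j \text{ on } (0,\pi),\qquad y_j(0)=0\quad (1\le j\le m),\qquad y_1(\pi)=y_j(\pi)\quad(2\le j\le m),\qquad \sum_{j=1}^m y_j'(\pi)=0 .$$ Let $S_j(x,\lambda)$ be the solution of the $j$-th equation with $S_j(0,\lambda)=0$, $S_j'(0,\lambda)=1$, and put $M_j(\lambda)=-S_j'(\pi,\lambda)/S_j(\pi,\lambda)$, $\omega_j=\frac12\int_0^\pi q_j(x)\,dx$, $\hat\omega=\frac1m\sum_{j=1}^m\omega_j$. Let $z_1$ be a root of the polynomial $P(z)=\frac{d}{dz}\prod_{k=1}^m(z-\omega_k)$. Let $\lambda_{nk}$ ($n\in\mathbb N=\{1,2,\dots\}$, $k=1,2$) be eigenvalues of $L$ such that $\rho_{nk}=\sqrt{\lambda_{nk}}$ satisfy $$\rho_{n1}=n-\tfrac12+\frac{\hat\omega}{\pi n}+\frac{\varkappa_{n1}}{n},\qquad \rho_{n2}=n+\frac{z_1}{\pi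 n}+\frac{\varkappa_{n2}}{n},\qquad \{\varkappa_{n1}\},\{\varkappa_{n2}\}\in l_2 .$$ Assume that (i) the numbers $\lambda_{nk}$ ($n\in\mathbb N$, $k=1,2$) are distinct; (ii) $\lambda_{nk}>0$; (iii) $S_j(\pi,\lambda_{nk})\ne0$ for all $n\in\mathbb N$, $k=1,2$, $1\le j\le m$; (iv) $z_1\ne\omega_j$ for $1\le j\le m$; (v) $S_1(\pi,0)\ne0$ and $S_1'(\pi,0)\ne0$. Put $g_{nk}=-\sum_{j=2}^m M_j(\lambda_{nk})$ and assume that $g_{n2}\neq0$ for all $n\in\mathbb N$. Define $$v_{n-1,1}(t)=\begin{bmatrix}\sin\rho_{n1}t\\ \frac{g_{n1}}{\rho_{n1}}\cos\rho_{n1}t\end{bmatrix},\quad v_{n2}(t)=\begin{bmatrix}\frac{\rho_{n2}}{g_{n2}}\sin\rho_{n2}t\\ \cos\rho_{n2}t\end{bmatrix}\quad(n\ge1),\qquad v_{02}(t)=\begin{bmatrix}0\\1\end{bmatrix}.$$ Then $\{v_{nk}\}_{n\ge0,\,k=1,2}$ is a Riesz basis of the real Hilbert space $L_2(0,\pi)\oplus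 L_2(0,\pi)$, that is, the image of an orthonormal basis under a bounded linear operator with bounded inverse. -/

import Mathlib

open MeasureTheory

noncomputable section

namespace StarGraph

/-- `y` is a solution, with derivative `dy`, of `-y'' + q y = lam y` on `(0, π)` for a potential
`q ∈ L₂(0, π)`: `y` is differentiable on `[0, π]` with `y' = dy`, and `dy` is the indefinite
integral of `(q - lam) y`, that is, `dy` is absolutely continuous with
`dy' = (q - lam) y` almost everywhere. -/
def IsSolution (q : ℝ → ℝ) (lam : ℝ) (y dy : ℝ → ℝ) : Prop :=
  (∀ x ∈ Set.Icc 0 Real.pi, HasDerivWithinAt y (dy x) (Set.Icc 0 Real.pi) x) ∧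
  (∀ x ∈ Set.Icc 0 Real.pi, dy x = dy 0 + ∫ t in (0 : ℝ)..x, (q t - lam) * y t)

/-- The pair `(S(·, lam), S'(·, lam))`, where `S` is the solution of `-y'' + q y = lam y` with
`S(0, lam) = 0`, `S'(0, lam) = 1`. For `q ∈ L₂(0, π)` it exists and is unique on `[0, π]`. -/
def sineSolution (q : ℝ → ℝ) (lam : ℝ) : (ℝ → ℝ) × (ℝ → ℝ) :=
  Classical.epsilon fun s => IsSolution q lam s.1 s.2 ∧ s.1 0 = 0 ∧ s.2 0 = 1

/-- `S(π, lam)`. -/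
def SPi (q : ℝ → ℝ) (lam : ℝ) : ℝ := (sineSolution q lam).1 Real.pi

/-- `S'(π, lam)`. -/
def dSPi (q : ℝ → ℝ) (lam : ℝ) : ℝ := (sineSolution q lam).2 Real.pi

/-- `lam` is an eigenvalue of the boundary value problem `L` on the star-shaped graph with edges
`1, …, m` of length `π` and potentials `q 1, …, q m`: there is a nontrivial solution of the
Sturm-Liouville equations with Dirichlet conditions at the boundary vertices, continuous at the
internal vertex and satisfying Kirchhoff's condition there. -/
def IsEigenvalue (m : ℕ) (q : ℕ → ℝ → ℝ) (lam : ℝ) : Prop :=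
  ∃ y dy : ℕ → ℝ → ℝ,
    (∀ j ∈ Finset.Icc 1 m, IsSolution (q j) lam (y j) (dy j)) ∧
    (∀ j ∈ Finset.Icc 1 m, y j 0 = 0) ∧
    (∀ j ∈ Finset.Icc 2 m, y 1 Real.pi = y j Real.pi) ∧
    ∑ j ∈ Finset.Icc 1 m, dy j Real.pi = 0 ∧
    ∃ j ∈ Finset.Icc 1 m, ∃ x ∈ Set.Icc 0 Real.pi, y j x ≠ 0

/-- `ω = ½ ∫₀^π q`. -/
def omega (q : ℝ → ℝ) : ℝ := (1 / 2) * ∫ x in (0 : ℝ)..Real.pi, q x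

/-- The mean of `ω_1, …, ω_m`. -/
def omegaHat (m : ℕ) (q : ℕ → ℝ → ℝ) : ℝ := (1 / (m : ℝ)) * ∑ j ∈ Finset.Icc 1 m, omega (q j)

/-- `P(z) = d/dz ∏_{k=1}^m (z - ω_k)`. -/
def charPoly (m : ℕ) (q : ℕ → ℝ → ℝ) : Polynomial ℝ :=
  Polynomial.derivative
    (∏ k ∈ Finset.Icc 1 m, (Polynomial.X - Polynomial.C (omega (q k))))

/-- `ρ_n = a_n + c / (π n) + ϰ_n / n` for all `n ≥ 1`, with some `ϰ ∈ l₂`. -/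
def HasAsymptotics (ρ a : ℕ → ℝ) (c : ℝ) : Prop :=
  ∃ ϰ : ℕ → ℝ, Summable (fun n => ϰ n ^ 2) ∧
    ∀ n : ℕ, 1 ≤ n → ρ n = a n + c / (Real.pi * n) + ϰ n / n

/-- The Weyl function `M(lam) = -S'(π, lam) / S(π, lam)`. -/
def weyl (q : ℝ → ℝ) (lam : ℝ) : ℝ := -(dSPi q lam / SPi q lam)

/-- `-∑_{j=2}^m M_j(lam)`; its value at `lam = λ_{nk}` is `g_{nk}`. -/
def g (m : ℕ) (q : ℕ → ℝ → ℝ) (lam : ℝ) : ℝ := -∑ j ∈ Finset.Icc 2 m, weyl (q j) lam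

/-- Lebesgue measure on `(0, π)`. -/
abbrev μ : Measure ℝ := volume.restrict (Set.Ioo 0 Real.pi)

/-- The real Hilbert space `L₂(0, π) ⊕ L₂(0, π)`. -/
abbrev H : Type := WithLp 2 (Lp ℝ 2 μ × Lp ℝ 2 μ)

theorem memLp_of_continuous (f : C(ℝ, ℝ)) : MemLp f 2 μ := by
  obtain ⟨C, hC⟩ := isCompact_Icc.exists_bound_of_continuousOn
    (s := Set.Icc 0 Real.pi) f.continuous.continuousOn
  refine MemLp.of_bound f.continuous.aestronglyMeasurable C ?_
  filter_upwards [ae_restrict_mem measurableSet_Ioo] with x hx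
  exact hC x (Set.Ioo_subset_Icc_self hx)

/-- The element `[f₁, f₂]` of `H` given by two continuous functions. -/
def vec (f₁ f₂ : C(ℝ, ℝ)) : H :=
  WithLp.toLp 2 ((memLp_of_continuous f₁).toLp f₁, (memLp_of_continuous f₂).toLp f₂)

/-- `t ↦ a sin(r t)`. -/
def sinFun (a r : ℝ) : C(ℝ, ℝ) := ⟨fun t => a * Real.sin (r * t), by fun_prop⟩

/-- `t ↦ a cos(r t)`. -/
def cosFun (a r : ℝ) : C(ℝ, ℝ) := ⟨fun t => a * Real.cos (r * t), by fun_prop⟩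

/-- `v_{n1}`, `n ≥ 0`: `v_{n-1,1} = [sin ρ_{n1} t, (g_{n1} / ρ_{n1}) cos ρ_{n1} t]` for `n ≥ 1`,
where `ρ_{nk} = √λ_{nk}`. -/
def v₁ (m : ℕ) (q : ℕ → ℝ → ℝ) (lam : ℕ → ℕ → ℝ) (n : ℕ) : H :=
  let ρ := Real.sqrt (lam (n + 1) 1)
  vec (sinFun 1 ρ) (cosFun (g m q (lam (n + 1) 1) / ρ) ρ)

/-- `v_{02} = [0, 1]` and `v_{n2} = [(ρ_{n2} / g_{n2}) sin ρ_{n2} t, cos ρ_{n2} t]` for `n ≥ 1`,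
where `ρ_{nk} = √λ_{nk}`. -/
def v₂ (m : ℕ) (q : ℕ → ℝ → ℝ) (lam : ℕ → ℕ → ℝ) (n : ℕ) : H :=
  let ρ := Real.sqrt (lam n 2)
  if n = 0 then vec (ContinuousMap.const ℝ 0) (ContinuousMap.const ℝ 1)
  else vec (sinFun (ρ / g m q (lam n 2)) ρ) (cosFun 1 ρ)

/-- A Riesz basis of a Hilbert space: the image of an orthonormal basis under a bounded linear
operator with bounded inverse. -/
def IsRieszBasis {ι E : Type*} [NormedAddCommGroup E] [InnerProductSpace ℝ E] (v : ι → E) : Prop :=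
  ∃ (e : HilbertBasis ι ℝ E) (A : E ≃L[ℝ] E), ∀ i, A (e i) = v i

end StarGraph

end

/-!
The family `v` is compared with the orthonormal basis consisting of `√(2/π) [sin (n + 1/2) t, 0]`,
`[0, 1/√π]` and `√(2/π) [0, cos n t]`. By Bari's criterion
(`isRieszBasis_of_quadratically_close`) it is enough that `v` is quadratically close to `√(π/2)`
times that basis and that only the zero vector is orthogonal to all of `v`: the operator
`x ↦ ∑ ⟪v i, x⟫ e i` is then a multiple of the identity plus a Hilbert–Schmidt operator and is
injective, hence invertible by the Fredholm alternative, and its adjoint maps `e i` to `v i`.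

Both conditions involve only the first edge. Write `S` and `S'` for the values at `π` of the sine
solution for `q 1` and of its derivative, as functions of `λ`. At an eigenvalue where no
`S_j(π, λ)` vanishes the matching conditions give `∑ S_j' / S_j = 0`, so `g = -S' / S` there
(`g_eq_of_isEigenvalue`).

*Closeness.* Since `ρ S = sin ρπ + O(1/ρ)` and `S' = cos ρπ + O(1/ρ)` (`sC_asymptotics`), the
coefficients `g / ρ = -S' / (ρ S)` at `ρ_{n1}` and `ρ / g = -ρ S / S'` at `ρ_{n2}` are `O(1/n)`.
The remaining components differ from `sin (n - 1/2) t` and `cos n t` by `O(1/n)` as well, because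
the asymptotics place `ρ_{n1}` and `ρ_{n2}` within `O(1/n)` of `n - 1/2` and `n`.

*Completeness.* Let `[f₁, f₂]` be orthogonal to all of `v`. Then the function
`h(ρ) = S(ρ²) ρ ∫ f₁ sin ρt - S'(ρ²) ∫ f₂ cos ρt` vanishes at `±ρ_{nk}`, and at `0` because of
`v_{02}`. It is even and entire and satisfies `|h(ρ)| ≤ B exp (2π |Im ρ|)` for large `|ρ|`.
Jensen's formula shows that these are more zeros than such a function can have, whence `h = 0`
(`eq_zero_of_zeros`). So `F₂ / S = F₁ / S'`, where `F₁ = ρ ∫ f₁ sin ρt` and `F₂ = ∫ f₂ cos ρt`.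
As `S` and `S'` have no common zeros, this quotient is entire; it is even, `O(ρ)` on the circles
`|ρ| = N + 1/2`, and zero at the origin because `S'(0) ≠ 0`. By Liouville's theorem it vanishes
(`transforms_eq_zero`), so `F₁ = F₂ = 0`, and the completeness of `sin (n + 1/2) t` and of
`cos n t` gives `f₁ = f₂ = 0`.
-/

namespace StarGraph

/-! ### Bari's criterion for Riesz bases -/

section RieszBasis

variable {ι E : Type*} [NormedAddCommGroup E] [InnerProductSpace ℝ E]

theorem summable_inner_sq {d : ι → E} (hd : Summable fun i => ‖d i‖ ^ 2) (x : E) :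
    Summable fun i => (inner ℝ (d i) x) ^ 2 := by
  refine Summable.of_nonneg_of_le (fun i => sq_nonneg _) (fun i => ?_) (hd.mul_right (‖x‖ ^ 2))
  rw [← mul_pow, ← sq_abs]
  exact pow_le_pow_left₀ (abs_nonneg _) (abs_real_inner_le_norm _ _) 2

/-- The Hilbert–Schmidt operator `x ↦ (⟪d i, x⟫)ᵢ` from `E` to `ℓ²` given by a square-summable
family `d`. -/
noncomputable def coeffMap (d : ι → E) (hd : Summable fun i => ‖d i‖ ^ 2) :
    E →L[ℝ] lp (fun _ : ι => ℝ) 2 :=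
  LinearMap.mkContinuous
    { toFun := fun x => ⟨fun i => inner ℝ (d i) x, memℓp_gen (by
        simpa using summable_inner_sq hd x)⟩
      map_add' := fun x y => by ext i; exact inner_add_right _ _ _
      map_smul' := fun a x => by ext i; simp [inner_smul_right] }
    (Real.sqrt (∑' i, ‖d i‖ ^ 2)) (fun x => by
      refine le_of_sq_le_sq ?_ (by positivity)
      rw [mul_pow, Real.sq_sqrt (tsum_nonneg fun i => sq_nonneg _), ← real_inner_self_eq_norm_sq,
        lp.inner_eq_tsum, ← tsum_mul_right]
      refine Summable.tsum_le_tsum (fun i => ?_) ?_ (hd.mul_right _)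
      · simp only [LinearMap.coe_mk, AddHom.coe_mk]
        rw [real_inner_self_eq_norm_sq, Real.norm_eq_abs, ← mul_pow]
        exact pow_le_pow_left₀ (abs_nonneg _) (abs_real_inner_le_norm _ _) 2
      · exact lp.summable_inner _ _)

theorem coeffMap_apply (d : ι → E) (hd : Summable fun i => ‖d i‖ ^ 2) (x : E) (i : ι) :
    coeffMap d hd x i = inner ℝ (d i) x := rfl

theorem norm_coeffMap_le (d : ι → E) (hd : Summable fun i => ‖d i‖ ^ 2) :
    ‖coeffMap d hd‖ ≤ Real.sqrt (∑' i, ‖d i‖ ^ 2) :=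
  LinearMap.mkContinuous_norm_le _ (Real.sqrt_nonneg _) _

theorem isCompactOperator_coeffMap (d : ι → E) (hd : Summable fun i => ‖d i‖ ^ 2) :
    IsCompactOperator (coeffMap d hd) := by
  classical
  -- `coeffMap d` is the norm limit of its truncations to finite index sets
  let T : Finset ι → (E →L[ℝ] lp (fun _ : ι => ℝ) 2) := fun s =>
    ∑ i ∈ s, (innerSL ℝ (d i)).smulRight (lp.single 2 i (1 : ℝ))
  have hT : ∀ s x i, T s x i = if i ∈ s then inner ℝ (d i) x else 0 := by
    intro s x i
    simp only [T, sum_apply, ContinuousLinearMap.smulRight_apply,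
      innerSL_apply_apply, lp.coeFn_sum, Finset.sum_apply, lp.coeFn_smul, Pi.smul_apply,
      lp.single_apply, Pi.single_apply, smul_eq_mul, mul_ite, mul_one, mul_zero,
      Finset.sum_ite_eq]
  have hcomp : ∀ s, IsCompactOperator (T s) := by
    intro s
    induction s using Finset.induction_on with
    | empty => simpa [T] using isCompactOperator_zero
    | insert i s hi ih =>
      have : T (insert i s) = (innerSL ℝ (d i)).smulRight (lp.single 2 i (1 : ℝ)) + T s := by
        simp [T, hi]
      rw [this]
      refine IsCompactOperator.add ?_ ih
      exact (isCompactOperator_of_locallyCompactSpace_rng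
        ((ContinuousLinearMap.id ℝ ℝ).smulRight (lp.single 2 i (1 : ℝ) : lp (fun _ : ι => ℝ) 2))).comp_clm
          (innerSL ℝ (d i))
  have hd' : ∀ s : Finset ι, Summable fun i => ‖(if i ∈ s then 0 else d i)‖ ^ 2 := by
    intro s
    refine Summable.of_nonneg_of_le (fun i => sq_nonneg _) (fun i => ?_) hd
    split_ifs <;> simp
  have hdiff : ∀ s, coeffMap d hd - T s = coeffMap (fun i => if i ∈ s then 0 else d i) (hd' s) := by
    intro s
    ext x i
    rw [coeffMap_apply]
    have : (coeffMap d hd - T s) x i = coeffMap d hd x i - T s x i := rfl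
    rw [this, hT, coeffMap_apply]
    split_ifs <;> simp
  refine isCompactOperator_of_tendsto (l := Filter.atTop) (F := T) ?_
    (Filter.Eventually.of_forall hcomp)
  rw [tendsto_iff_norm_sub_tendsto_zero]
  refine squeeze_zero (fun _ => norm_nonneg _)
    (g := fun s : Finset ι => Real.sqrt (∑' i, ‖d i‖ ^ 2 - ∑ i ∈ s, ‖d i‖ ^ 2)) (fun s => ?_) ?_
  · rw [norm_sub_rev, hdiff]
    refine (norm_coeffMap_le _ _).trans (Real.sqrt_le_sqrt ?_)
    rw [← hd.sum_add_tsum_compl (s := s), add_sub_cancel_left]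
    rw [← (hd' s).sum_add_tsum_compl (s := s), Finset.sum_eq_zero (fun i hi => by simp [hi]),
      zero_add]
    refine le_of_eq (tsum_congr fun i => ?_)
    rw [if_neg]
    exact fun h => i.2 (Finset.mem_coe.2 h)
  · have : Filter.Tendsto (fun s : Finset ι => ∑' i, ‖d i‖ ^ 2 - ∑ i ∈ s, ‖d i‖ ^ 2)
        Filter.atTop (nhds (∑' i, ‖d i‖ ^ 2 - ∑' i, ‖d i‖ ^ 2)) :=
      tendsto_const_nhds.sub hd.hasSum
    rw [sub_self] at this
    simpa using this.sqrt

/-- **Bari's theorem**: a complete family quadratically close to a multiple of an orthonormal basis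
is a Riesz basis. The operator `x ↦ ∑ ⟪v i, x⟫ e i` is a nonzero multiple of the identity plus a
compact operator, and it is injective by completeness; by the Fredholm alternative it is invertible,
and its adjoint maps `e i` to `v i`. -/
theorem isRieszBasis_of_quadratically_close [CompleteSpace E] (e : HilbertBasis ι ℝ E) (v : ι → E)
    {c : ℝ} (hc : c ≠ 0) (hs : Summable fun i => ‖v i - c • e i‖ ^ 2)
    (hcomplete : ∀ x, (∀ i, inner ℝ (v i) x = 0) → x = 0) : IsRieszBasis v := by
  let L : E →L[ℝ] E :=
    (e.repr.symm.toContinuousLinearEquiv : lp (fun _ : ι => ℝ) 2 →L[ℝ] E) ∘L coeffMap _ hs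
  have hL : IsCompactOperator L := (isCompactOperator_coeffMap _ hs).clm_comp
    (e.repr.symm.toContinuousLinearEquiv : lp (fun _ : ι => ℝ) 2 →L[ℝ] E)
  have hrepr : ∀ x i, inner ℝ (e i) (L x) = inner ℝ (v i) x - c * inner ℝ (e i) x := by
    intro x i
    rw [← e.repr_apply_apply]
    simp [L, coeffMap_apply, inner_sub_left, inner_smul_left]
  let U : E →L[ℝ] E := L + c • ContinuousLinearMap.id ℝ E
  have hU : ∀ x i, inner ℝ (e i) (U x) = inner ℝ (v i) x := by
    intro x i
    simp [U, inner_add_right, inner_smul_right, hrepr]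
  have hinj : ∀ x, U x = 0 → x = 0 := fun x hx =>
    hcomplete x fun i => by rw [← hU, hx, inner_zero_right]
  have hunit : IsUnit U := by
    rcases hL.hasEigenvalue_or_mem_resolventSet (neg_ne_zero.2 hc) with h | h
    · exfalso
      obtain ⟨x, hx⟩ := h.exists_hasEigenvector
      refine hx.2 (hinj x ?_)
      have := hx.apply_eq_smul
      simp only [ContinuousLinearMap.coe_coe] at this
      simp [U, this]
    · rw [spectrum.mem_resolventSet_iff] at h
      convert h.neg using 1
      ext x
      simp [U, Algebra.algebraMap_eq_smul_one, add_comm]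
  have hA : IsUnit (ContinuousLinearMap.adjoint U) := by
    rw [← ContinuousLinearMap.star_eq_adjoint]
    exact hunit.star
  have hbij := ContinuousLinearMap.isUnit_iff_bijective.1 hA
  let A := ContinuousLinearEquiv.ofBijective (ContinuousLinearMap.adjoint U)
    (LinearMap.ker_eq_bot.2 hbij.1) (LinearMap.range_eq_top.2 hbij.2)
  refine ⟨e, A, fun i => ext_inner_right ℝ fun x => ?_⟩
  rw [← hU]
  have : A (e i) = ContinuousLinearMap.adjoint U (e i) := rfl
  rw [this, ContinuousLinearMap.adjoint_inner_left]

end RieszBasis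

/-! ### The trigonometric orthonormal basis -/

section TrigonometricBasis

theorem integral_μ (f : ℝ → ℝ) : ∫ t, f t ∂μ = ∫ t in (0 : ℝ)..Real.pi, f t := by
  rw [intervalIntegral.integral_of_le Real.pi_pos.le, integral_Ioc_eq_integral_Ioo]

theorem inner_vec (f₁ f₂ : C(ℝ, ℝ)) (x : H) : inner ℝ (vec f₁ f₂) x =
    (∫ t in (0 : ℝ)..Real.pi, f₁ t * x.fst t) + ∫ t in (0 : ℝ)..Real.pi, f₂ t * x.snd t := by
  rw [WithLp.prod_inner_apply, L2.inner_def, L2.inner_def, ← integral_μ, ← integral_μ]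
  congr 1
  · refine integral_congr_ae ?_
    filter_upwards [(memLp_of_continuous f₁).coeFn_toLp] with t ht
    simp only [vec, ht, RCLike.inner_apply, conj_trivial]
    exact mul_comm _ _
  · refine integral_congr_ae ?_
    filter_upwards [(memLp_of_continuous f₂).coeFn_toLp] with t ht
    simp only [vec, ht, RCLike.inner_apply, conj_trivial]
    exact mul_comm _ _

theorem inner_vec_vec (f₁ f₂ g₁ g₂ : C(ℝ, ℝ)) : inner ℝ (vec f₁ f₂) (vec g₁ g₂) =
    (∫ t in (0 : ℝ)..Real.pi, f₁ t * g₁ t) + ∫ t in (0 : ℝ)..Real.pi, f₂ t * g₂ t := by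
  rw [inner_vec, ← integral_μ, ← integral_μ, ← integral_μ, ← integral_μ]
  congr 1
  · refine integral_congr_ae ?_
    filter_upwards [(memLp_of_continuous g₁).coeFn_toLp] with t ht
    exact congrArg _ ht
  · refine integral_congr_ae ?_
    filter_upwards [(memLp_of_continuous g₂).coeFn_toLp] with t ht
    exact congrArg _ ht

theorem integral_cos_int_mul (k : ℤ) :
    ∫ t in (0 : ℝ)..Real.pi, Real.cos (k * t) = if k = 0 then Real.pi else 0 := by
  split_ifs with h
  · simp [h]
  · rw [intervalIntegral.integral_comp_mul_left (f := Real.cos) (by exact_mod_cast h), integral_cos]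
    simp [Real.sin_int_mul_pi]

/-- The orthonormal basis of `H` made of the functions `√(2/π) [sin (n + 1/2) t, 0]`, `[0, 1/√π]`
and `√(2/π) [0, cos n t]`. -/
noncomputable def trigVec : ℕ ⊕ ℕ → H
  | Sum.inl n => vec (sinFun (Real.sqrt (2 / Real.pi)) (n + 1 / 2)) 0
  | Sum.inr n => vec 0
      (cosFun (if n = 0 then Real.sqrt (1 / Real.pi) else Real.sqrt (2 / Real.pi)) n)

theorem integral_sin_mul_sin (n m : ℕ) :
    ∫ t in (0 : ℝ)..Real.pi, Real.sin ((n + 1 / 2) * t) * Real.sin ((m + 1 / 2) * t) =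
      if n = m then Real.pi / 2 else 0 := by
  have h : ∀ t : ℝ, Real.sin ((n + 1 / 2) * t) * Real.sin ((m + 1 / 2) * t) =
      (1 / 2) * (Real.cos (((n - m : ℤ) : ℝ) * t) - Real.cos (((n + m + 1 : ℤ) : ℝ) * t)) := by
    intro t
    have h1 := Real.cos_sub ((n + 1 / 2) * t) ((m + 1 / 2) * t)
    have h2 := Real.cos_add ((n + 1 / 2) * t) ((m + 1 / 2) * t)
    have e1 : ((n - m : ℤ) : ℝ) * t = (n + 1 / 2) * t - (m + 1 / 2) * t := by push_cast; ring
    have e2 : ((n + m + 1 : ℤ) : ℝ) * t = (n + 1 / 2) * t + (m + 1 / 2) * t := by push_cast; ring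
    rw [e1, e2, h1, h2]
    ring
  simp_rw [h]
  rw [intervalIntegral.integral_const_mul, intervalIntegral.integral_sub
    (Continuous.intervalIntegrable (by fun_prop) _ _)
    (Continuous.intervalIntegrable (by fun_prop) _ _), integral_cos_int_mul, integral_cos_int_mul,
    if_neg (by omega : ¬ ((n : ℤ) + m + 1 = 0))]
  by_cases hnm : n = m
  · simp [hnm]; ring
  · rw [if_neg hnm, if_neg (by omega)]; simp

theorem integral_cos_mul_cos (n m : ℕ) :
    ∫ t in (0 : ℝ)..Real.pi, Real.cos (n * t) * Real.cos (m * t) =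
      if n = m then (if n = 0 then Real.pi else Real.pi / 2) else 0 := by
  have h : ∀ t : ℝ, Real.cos (n * t) * Real.cos (m * t) =
      (1 / 2) * (Real.cos (((n - m : ℤ) : ℝ) * t) + Real.cos (((n + m : ℤ) : ℝ) * t)) := by
    intro t
    have h1 := Real.cos_sub (n * t) (m * t)
    have h2 := Real.cos_add (n * t) (m * t)
    have e1 : ((n - m : ℤ) : ℝ) * t = n * t - m * t := by push_cast; ring
    have e2 : ((n + m : ℤ) : ℝ) * t = n * t + m * t := by push_cast; ring
    rw [e1, e2, h1, h2]
    ring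
  simp_rw [h]
  rw [intervalIntegral.integral_const_mul, intervalIntegral.integral_add
    (Continuous.intervalIntegrable (by fun_prop) _ _)
    (Continuous.intervalIntegrable (by fun_prop) _ _), integral_cos_int_mul, integral_cos_int_mul]
  by_cases hnm : n = m
  · subst hnm
    by_cases hn : n = 0
    · simp [hn]; ring
    · rw [if_pos (by omega), if_neg (by omega), if_pos rfl, if_neg hn]; ring
  · rw [if_neg hnm, if_neg (by omega), if_neg (by omega)]; simp

theorem orthonormal_trigVec : Orthonormal ℝ trigVec := by
  have hπ := Real.pi_pos
  rw [orthonormal_iff_ite]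
  rintro (n | n) (m | m)
  · simp only [trigVec, inner_vec_vec, sinFun, ContinuousMap.coe_mk, ContinuousMap.zero_apply,
      mul_zero, intervalIntegral.integral_zero, add_zero, Sum.inl.injEq]
    have : ∀ t : ℝ, Real.sqrt (2 / Real.pi) * Real.sin ((n + 1 / 2) * t) *
        (Real.sqrt (2 / Real.pi) * Real.sin ((m + 1 / 2) * t)) =
        (2 / Real.pi) * (Real.sin ((n + 1 / 2) * t) * Real.sin ((m + 1 / 2) * t)) := by
      intro t
      nth_rewrite 3 [← Real.mul_self_sqrt (show 0 ≤ 2 / Real.pi by positivity)]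
      ring
    simp_rw [this]
    rw [intervalIntegral.integral_const_mul, integral_sin_mul_sin]
    split_ifs
    · field_simp
    · simp
  · simp only [trigVec, inner_vec_vec]; simp
  · simp only [trigVec, inner_vec_vec]; simp
  · simp only [trigVec, inner_vec_vec, cosFun, ContinuousMap.coe_mk, ContinuousMap.zero_apply,
      mul_zero, intervalIntegral.integral_zero, zero_add, Sum.inr.injEq]
    have : ∀ a b t : ℝ, a * Real.cos (n * t) * (b * Real.cos (m * t)) =
        (a * b) * (Real.cos (n * t) * Real.cos (m * t)) := fun a b t => by ring
    simp_rw [this]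
    rw [intervalIntegral.integral_const_mul, integral_cos_mul_cos]
    by_cases hnm : n = m
    · subst hnm
      by_cases hn : n = 0
      · simp only [hn, if_true]
        rw [Real.mul_self_sqrt (by positivity)]
        field_simp
      · simp only [hn, if_true, if_false]
        rw [Real.mul_self_sqrt (by positivity)]
        field_simp
    · simp [hnm]

theorem intervalIntegrable_mul_continuous {f : ℝ → ℝ} {φ : ℝ → ℝ}
    (hf : IntervalIntegrable f volume 0 Real.pi) (hφ : Continuous φ) :
    IntervalIntegrable (fun t => φ t * f t) volume 0 Real.pi :=
  hf.continuousOn_mul hφ.continuousOn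

theorem intervalIntegrable_Lp (f : Lp ℝ 2 μ) : IntervalIntegrable f volume 0 Real.pi := by
  rw [intervalIntegrable_iff_integrableOn_Ioo_of_le Real.pi_pos.le]
  exact (Lp.memLp f).integrable (by norm_num)

/-- Completeness of the cosines: by Weierstrass, polynomials in `cos t` are dense in
`C[0, π]`. -/
theorem ae_eq_zero_of_integral_cos_eq_zero {f : ℝ → ℝ}
    (hf : IntervalIntegrable f volume 0 Real.pi)
    (h : ∀ n : ℕ, ∫ t in (0 : ℝ)..Real.pi, Real.cos (n * t) * f t = 0) :
    ∀ᵐ t ∂μ, f t = 0 := by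
  have hz : ∀ n : ℤ, ∫ t in (0 : ℝ)..Real.pi, Real.cos (n * t) * f t = 0 := by
    intro n
    rcases n.natAbs_eq with hn | hn
    · rw [hn]; simpa using h n.natAbs
    · rw [hn]; simpa using h n.natAbs
  have hpow : ∀ k : ℕ, ∀ n : ℤ,
      ∫ t in (0 : ℝ)..Real.pi, (Real.cos t ^ k * Real.cos (n * t)) * f t = 0 := by
    intro k
    induction k with
    | zero => intro n; simpa using hz n
    | succ k ih =>
      intro n
      have : ∀ t : ℝ, (Real.cos t ^ (k + 1) * Real.cos (n * t)) * f t =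
          (1 / 2) * ((Real.cos t ^ k * Real.cos ((n + 1 : ℤ) * t)) * f t +
            (Real.cos t ^ k * Real.cos ((n - 1 : ℤ) * t)) * f t) := by
        intro t
        have e1 : ((n + 1 : ℤ) : ℝ) * t = n * t + t := by push_cast; ring
        have e2 : ((n - 1 : ℤ) : ℝ) * t = n * t - t := by push_cast; ring
        rw [e1, e2, Real.cos_add, Real.cos_sub]
        ring
      simp_rw [this]
      rw [intervalIntegral.integral_const_mul, intervalIntegral.integral_add
        (intervalIntegrable_mul_continuous hf (by fun_prop))
        (intervalIntegrable_mul_continuous hf (by fun_prop)), ih, ih]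
      simp
  have hpoly : ∀ p : Polynomial ℝ,
      ∫ t in (0 : ℝ)..Real.pi, p.eval (Real.cos t) * f t = 0 := by
    intro p
    induction p using Polynomial.induction_on' with
    | add p r hp hr =>
      simp only [Polynomial.eval_add, add_mul]
      rw [intervalIntegral.integral_add
        (intervalIntegrable_mul_continuous hf (by fun_prop))
        (intervalIntegrable_mul_continuous hf (by fun_prop)), hp, hr, add_zero]
    | monomial n a =>
      simp only [Polynomial.eval_monomial, mul_assoc]
      rw [intervalIntegral.integral_const_mul]
      have := hpow n 0
      simp only [Int.cast_zero, zero_mul, Real.cos_zero, mul_one] at this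
      rw [this, mul_zero]
  have hcont : ∀ φ : ℝ → ℝ, Continuous φ → ∫ t in (0 : ℝ)..Real.pi, φ t * f t = 0 := by
    intro φ hφ
    by_contra hne
    set I := ∫ t in (0 : ℝ)..Real.pi, φ t * f t with hI
    set N := ∫ t in (0 : ℝ)..Real.pi, ‖f t‖ with hN
    have hN0 : 0 ≤ N := intervalIntegral.integral_nonneg Real.pi_pos.le fun _ _ => norm_nonneg _
    have hε : 0 < |I| / (2 * (N + 1)) := by positivity
    obtain ⟨p, hp⟩ := exists_polynomial_near_of_continuousOn (-1) 1 (fun x => φ (Real.arccos x))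
      (hφ.comp Real.continuous_arccos).continuousOn _ hε
    have h1 : I = ∫ t in (0 : ℝ)..Real.pi, (φ t - p.eval (Real.cos t)) * f t := by
      simp only [sub_mul]
      rw [intervalIntegral.integral_sub (intervalIntegrable_mul_continuous hf hφ)
        (intervalIntegrable_mul_continuous hf (by fun_prop)), hpoly, sub_zero]
    have h2 : |I| ≤ ∫ t in (0 : ℝ)..Real.pi, |I| / (2 * (N + 1)) * ‖f t‖ := by
      rw [h1]
      refine intervalIntegral.norm_integral_le_of_norm_le (E := ℝ) Real.pi_pos.le ?_ (hf.norm.const_mul _)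
      refine Filter.Eventually.of_forall fun t ht => ?_
      rw [norm_mul]
      refine mul_le_mul_of_nonneg_right ?_ (norm_nonneg _)
      have := hp (Real.cos t) ⟨Real.neg_one_le_cos t, Real.cos_le_one t⟩
      rw [Real.arccos_cos ht.1.le ht.2] at this
      rw [Real.norm_eq_abs, abs_sub_comm, ← h1]
      exact this.le
    rw [intervalIntegral.integral_const_mul, ← hN] at h2
    have h3 : |I| / (2 * (N + 1)) * N < |I| := by
      have : 0 < |I| := abs_pos.2 hne
      rw [div_mul_eq_mul_div, div_lt_iff₀ (by positivity)]
      nlinarith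
    linarith
  have hint : IntegrableOn f (Set.Ioo 0 Real.pi) :=
    (intervalIntegrable_iff_integrableOn_Ioo_of_le Real.pi_pos.le).1 hf
  refine ae_eq_zero_of_integral_contDiff_smul_eq_zero hint.locallyIntegrable fun φ hφ _ => ?_
  have := hcont φ hφ.continuous
  rw [← integral_μ] at this
  exact this

/-- Completeness of the functions `sin (n + 1/2) t`: consecutive differences are
`2 sin (t / 2) cos (n t)`. -/
theorem ae_eq_zero_of_integral_sin_eq_zero {f : ℝ → ℝ}
    (hf : IntervalIntegrable f volume 0 Real.pi)
    (h : ∀ n : ℕ, ∫ t in (0 : ℝ)..Real.pi, Real.sin ((n + 1 / 2) * t) * f t = 0) :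
    ∀ᵐ t ∂μ, f t = 0 := by
  have key : ∀ᵐ t ∂μ, Real.sin (t / 2) * f t = 0 := by
    refine ae_eq_zero_of_integral_cos_eq_zero
      (intervalIntegrable_mul_continuous hf (by fun_prop)) fun n => ?_
    rcases n with _ | n
    · have := h 0
      simp only [Nat.cast_zero, zero_mul, Real.cos_zero, one_mul]
      refine Eq.trans ?_ this
      refine intervalIntegral.integral_congr fun t _ => ?_
      simp only [Nat.cast_zero]
      congr 2
      ring
    · have e : ∀ t : ℝ, Real.cos ((n + 1 : ℕ) * t) * (Real.sin (t / 2) * f t) =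
          (1 / 2) * (Real.sin (((n + 1 : ℕ) + 1 / 2) * t) * f t -
            Real.sin ((n + 1 / 2) * t) * f t) := by
        intro t
        have e1 : (((n + 1 : ℕ) : ℝ) + 1 / 2) * t = (n + 1 : ℕ) * t + t / 2 := by ring
        have e2 : ((n : ℝ) + 1 / 2) * t = (n + 1 : ℕ) * t - t / 2 := by push_cast; ring
        rw [e1, e2, Real.sin_add, Real.sin_sub]
        ring
      simp_rw [e]
      rw [intervalIntegral.integral_const_mul, intervalIntegral.integral_sub
        (intervalIntegrable_mul_continuous hf (by fun_prop))
        (intervalIntegrable_mul_continuous hf (by fun_prop)), h, h]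
      simp
  filter_upwards [key, ae_restrict_mem measurableSet_Ioo] with t ht hmem
  have : Real.sin (t / 2) ≠ 0 :=
    (Real.sin_pos_of_pos_of_lt_pi (by linarith [hmem.1]) (by linarith [hmem.1, hmem.2])).ne'
  simpa [this] using ht

theorem H_eq_zero {x : H} (h₁ : ∀ᵐ t ∂μ, x.fst t = 0) (h₂ : ∀ᵐ t ∂μ, x.snd t = 0) : x = 0 := by
  have e₁ : x.fst = 0 := Lp.ext (Filter.EventuallyEq.trans h₁ (Lp.coeFn_zero ℝ 2 μ).symm)
  have e₂ : x.snd = 0 := Lp.ext (Filter.EventuallyEq.trans h₂ (Lp.coeFn_zero ℝ 2 μ).symm)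
  exact (WithLp.ofLp_injective 2) (Prod.ext e₁ e₂)

/-- Completeness of the trigonometric system in `H`. -/
theorem span_trigVec_orthogonal : (Submodule.span ℝ (Set.range trigVec))ᗮ = ⊥ := by
  rw [Submodule.eq_bot_iff]
  intro x hx
  have hx' : ∀ i, inner ℝ (trigVec i) x = 0 := fun i =>
    (Submodule.mem_orthogonal _ _).1 hx _ (Submodule.subset_span ⟨i, rfl⟩)
  have hπ := Real.pi_pos
  have h2 : Real.sqrt (2 / Real.pi) ≠ 0 := by positivity
  have h1 : Real.sqrt (1 / Real.pi) ≠ 0 := by positivity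
  refine H_eq_zero ?_ ?_
  · refine ae_eq_zero_of_integral_sin_eq_zero (intervalIntegrable_Lp _) fun n => ?_
    have := hx' (Sum.inl n)
    simp only [trigVec, inner_vec, sinFun, ContinuousMap.coe_mk, ContinuousMap.zero_apply,
      zero_mul, intervalIntegral.integral_zero, add_zero, mul_assoc] at this
    rw [intervalIntegral.integral_const_mul] at this
    simpa only [mul_assoc] using (mul_eq_zero.1 this).resolve_left h2
  · refine ae_eq_zero_of_integral_cos_eq_zero (intervalIntegrable_Lp _) fun n => ?_
    have := hx' (Sum.inr n)
    simp only [trigVec, inner_vec, cosFun, ContinuousMap.coe_mk, ContinuousMap.zero_apply,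
      zero_mul, intervalIntegral.integral_zero, zero_add, mul_assoc] at this
    rw [intervalIntegral.integral_const_mul] at this
    refine (mul_eq_zero.1 this).resolve_left ?_
    split_ifs <;> assumption

/-- The Hilbert basis `trigVec`. -/
noncomputable def trigBasis : HilbertBasis (ℕ ⊕ ℕ) ℝ H :=
  HilbertBasis.mkOfOrthogonalEqBot orthonormal_trigVec span_trigVec_orthogonal

theorem trigBasis_apply (i : ℕ ⊕ ℕ) : trigBasis i = trigVec i := by
  rw [trigBasis, HilbertBasis.coe_mkOfOrthogonalEqBot]

end TrigonometricBasis

/-! ### Volterra operators -/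

section Volterra

/-- The space of continuous complex functions on `[0, π]`. -/
abbrev CSpace : Type := C(Set.Icc (0 : ℝ) Real.pi, ℂ)

/-- The constant extension of a function on `[0, π]` to the real line. -/
noncomputable abbrev ext (y : CSpace) : ℝ → ℂ := Set.IccExtend Real.pi_pos.le y

theorem continuous_ext (y : CSpace) : Continuous (ext y) := y.continuous.Icc_extend'

theorem ext_of_mem (y : CSpace) {x : ℝ} (hx : x ∈ Set.Icc 0 Real.pi) : ext y x = y ⟨x, hx⟩ :=
  Set.IccExtend_of_mem _ _ hx

theorem norm_ext_le (y : CSpace) (x : ℝ) : ‖ext y x‖ ≤ ‖y‖ := y.norm_coe_le_norm _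

theorem intervalIntegrable_sub {a b : ℝ} {φ : ℝ → ℂ} (hφ : IntervalIntegrable φ volume 0 Real.pi)
    (ha : a ∈ Set.Icc 0 Real.pi) (hb : b ∈ Set.Icc 0 Real.pi) :
    IntervalIntegrable φ volume a b := by
  refine hφ.mono_set ?_
  rw [Set.uIcc_of_le Real.pi_pos.le]
  exact Set.uIcc_subset_Icc ha hb

theorem zero_mem : (0 : ℝ) ∈ Set.Icc 0 Real.pi := ⟨le_rfl, Real.pi_pos.le⟩

theorem pi_mem : Real.pi ∈ Set.Icc 0 Real.pi := ⟨Real.pi_pos.le, le_rfl⟩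

theorem continuousOn_primitive {φ : ℝ → ℂ} (hφ : IntervalIntegrable φ volume 0 Real.pi) :
    ContinuousOn (fun x => ∫ t in (0 : ℝ)..x, φ t) (Set.Icc 0 Real.pi) := by
  have := intervalIntegral.continuousOn_primitive_interval' hφ Set.left_mem_uIcc
  rwa [Set.uIcc_of_le Real.pi_pos.le] at this

theorem intervalIntegrable_mul_ext {φ : ℝ → ℂ} (hφ : IntervalIntegrable φ volume 0 Real.pi)
    (y : CSpace) : IntervalIntegrable (fun t => φ t * ext y t) volume 0 Real.pi :=
  hφ.mul_continuousOn (continuous_ext y).continuousOn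

/-- The Volterra operator `y ↦ (x ↦ ∫₀ˣ φ y)` on `C[0, π]` with an integrable weight `φ`. -/
noncomputable def volterra (φ : ℝ → ℂ) (hφ : IntervalIntegrable φ volume 0 Real.pi) :
    CSpace →L[ℂ] CSpace :=
  LinearMap.mkContinuous
    { toFun := fun y => ⟨fun x => ∫ t in (0 : ℝ)..x, φ t * ext y t,
        (continuousOn_primitive (intervalIntegrable_mul_ext hφ y)).comp_continuous
          continuous_subtype_val fun x => x.2⟩
      map_add' := fun y z => by
        ext x
        simp only [ContinuousMap.coe_mk, ContinuousMap.add_apply]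
        rw [← intervalIntegral.integral_add
          (intervalIntegrable_sub (intervalIntegrable_mul_ext hφ y) zero_mem x.2)
          (intervalIntegrable_sub (intervalIntegrable_mul_ext hφ z) zero_mem x.2)]
        exact intervalIntegral.integral_congr fun t _ => mul_add _ _ _
      map_smul' := fun a y => by
        ext x
        simp only [ContinuousMap.coe_mk, ContinuousMap.smul_apply, RingHom.id_apply, smul_eq_mul]
        rw [← intervalIntegral.integral_const_mul]
        exact intervalIntegral.integral_congr fun t _ => mul_left_comm _ _ _ }
    (∫ t in (0 : ℝ)..Real.pi, ‖φ t‖) (fun y => by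
      refine (ContinuousMap.norm_le _ (mul_nonneg (intervalIntegral.integral_nonneg
        Real.pi_pos.le fun _ _ => norm_nonneg _) (norm_nonneg _))).2 fun x => ?_
      simp only [LinearMap.coe_mk, AddHom.coe_mk, ContinuousMap.coe_mk]
      calc ‖∫ t in (0 : ℝ)..x, φ t * ext y t‖ ≤ ∫ t in (0 : ℝ)..x, ‖φ t‖ * ‖y‖ := by
            refine intervalIntegral.norm_integral_le_of_norm_le x.2.1
              (Filter.Eventually.of_forall fun t _ => ?_)
              ((intervalIntegrable_sub hφ zero_mem x.2).norm.mul_const _)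
            rw [norm_mul]
            exact mul_le_mul_of_nonneg_left (norm_ext_le y t) (norm_nonneg _)
        _ = (∫ t in (0 : ℝ)..x, ‖φ t‖) * ‖y‖ := intervalIntegral.integral_mul_const _ _
        _ ≤ _ := mul_le_mul_of_nonneg_right (intervalIntegral.integral_mono_interval le_rfl x.2.1
            x.2.2 (Filter.Eventually.of_forall fun _ => norm_nonneg _) hφ.norm) (norm_nonneg _))

theorem volterra_apply {φ : ℝ → ℂ} (hφ : IntervalIntegrable φ volume 0 Real.pi) (y : CSpace)
    (x : Set.Icc (0 : ℝ) Real.pi) : volterra φ hφ y x = ∫ t in (0 : ℝ)..x, φ t * ext y t := rfl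

theorem intervalIntegrable_one : IntervalIntegrable (fun _ : ℝ => (1 : ℂ)) volume 0 Real.pi :=
  intervalIntegrable_const

/-- Integration `y ↦ (x ↦ ∫₀ˣ y)` on `C[0, π]`. -/
noncomputable def integ : CSpace →L[ℂ] CSpace := volterra (fun _ => 1) intervalIntegrable_one

theorem integ_apply (y : CSpace) (x : Set.Icc (0 : ℝ) Real.pi) :
    integ y x = ∫ t in (0 : ℝ)..x, ext y t := by
  rw [integ, volterra_apply]
  simp

/-- The iterates of the Volterra operator `∫ ∘ φ∫` decay factorially. -/
theorem norm_pow_apply_le {φ : ℝ → ℂ} (hφ : IntervalIntegrable φ volume 0 Real.pi) (n : ℕ)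
    (y : CSpace) (x : Set.Icc (0 : ℝ) Real.pi) :
    ‖((integ * volterra φ hφ) ^ n) y x‖ ≤
      (∫ t in (0 : ℝ)..Real.pi, ‖φ t‖) ^ n * ‖y‖ * (x : ℝ) ^ n / n.factorial := by
  set N := ∫ t in (0 : ℝ)..Real.pi, ‖φ t‖ with hN
  have hN0 : 0 ≤ N := intervalIntegral.integral_nonneg Real.pi_pos.le fun _ _ => norm_nonneg _
  induction n generalizing x with
  | zero => simpa using y.norm_coe_le_norm x
  | succ n ih =>
    set z := ((integ * volterra φ hφ) ^ n) y with hz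
    have hstep : ((integ * volterra φ hφ) ^ (n + 1)) y = integ (volterra φ hφ z) := by
      rw [pow_succ']; rfl
    have h1 : ∀ s : Set.Icc (0 : ℝ) Real.pi,
        ‖volterra φ hφ z s‖ ≤ N ^ (n + 1) * ‖y‖ / n.factorial * (s : ℝ) ^ n := by
      intro s
      rw [volterra_apply]
      calc ‖∫ t in (0 : ℝ)..s, φ t * ext z t‖
          ≤ ∫ t in (0 : ℝ)..s, ‖φ t‖ * (N ^ n * ‖y‖ * (s : ℝ) ^ n / n.factorial) := by
            refine intervalIntegral.norm_integral_le_of_norm_le s.2.1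
              (Filter.Eventually.of_forall fun t ht => ?_)
              ((intervalIntegrable_sub hφ zero_mem s.2).norm.mul_const _)
            rw [norm_mul]
            refine mul_le_mul_of_nonneg_left ?_ (norm_nonneg _)
            have htm : t ∈ Set.Icc 0 Real.pi := ⟨ht.1.le, ht.2.trans s.2.2⟩
            rw [ext_of_mem z htm]
            refine (ih ⟨t, htm⟩).trans ?_
            have := pow_le_pow_left₀ ht.1.le ht.2 n
            gcongr
        _ = (∫ t in (0 : ℝ)..s, ‖φ t‖) * (N ^ n * ‖y‖ * (s : ℝ) ^ n / n.factorial) :=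
            intervalIntegral.integral_mul_const _ _
        _ ≤ N * (N ^ n * ‖y‖ * (s : ℝ) ^ n / n.factorial) := by
            have hs := s.2.1
            exact mul_le_mul_of_nonneg_right (intervalIntegral.integral_mono_interval le_rfl s.2.1
              s.2.2 (Filter.Eventually.of_forall fun _ => norm_nonneg _) hφ.norm) (by positivity)
        _ = _ := by ring
    rw [hstep, integ_apply]
    calc ‖∫ t in (0 : ℝ)..x, ext (volterra φ hφ z) t‖
        ≤ ∫ t in (0 : ℝ)..x, N ^ (n + 1) * ‖y‖ / n.factorial * t ^ n := by
          refine intervalIntegral.norm_integral_le_of_norm_le x.2.1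
            (Filter.Eventually.of_forall fun t ht => ?_)
            (Continuous.intervalIntegrable (by fun_prop) _ _)
          have htm : t ∈ Set.Icc 0 Real.pi := ⟨ht.1.le, ht.2.trans x.2.2⟩
          rw [ext_of_mem _ htm]
          exact h1 ⟨t, htm⟩
      _ = _ := by
          rw [intervalIntegral.integral_const_mul, integral_pow, Nat.factorial_succ]
          push_cast
          field_simp
          simp

theorem isUnit_one_sub_of_norm_pow_lt_one {R : Type*} [NormedRing R] [HasSummableGeomSeries R]
    {V : R} {n : ℕ} (h : ‖V ^ n‖ < 1) : IsUnit (1 - V) := by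
  have hunit := isUnit_one_sub_of_norm_lt_one h
  rw [← mul_neg_geom_sum V n] at hunit
  have hcomm : Commute (1 - V) (∑ i ∈ Finset.range n, V ^ i) :=
    Commute.sum_right _ _ _ fun i _ => by
      rw [Commute, SemiconjBy, sub_mul, mul_sub, one_mul, mul_one, ← pow_succ, ← pow_succ']
  exact (hcomm.isUnit_mul_iff.1 hunit).1

/-- The operator `∫ ∘ φ∫` is quasinilpotent, so `1` minus it is invertible. -/
theorem isUnit_one_sub_integ_mul_volterra {φ : ℝ → ℂ}
    (hφ : IntervalIntegrable φ volume 0 Real.pi) : IsUnit (1 - integ * volterra φ hφ) := by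
  set V := integ * volterra φ hφ with hV
  set N := ∫ t in (0 : ℝ)..Real.pi, ‖φ t‖ with hN
  have hN0 : 0 ≤ N := intervalIntegral.integral_nonneg Real.pi_pos.le fun _ _ => norm_nonneg _
  have hπ := Real.pi_pos
  obtain ⟨n, hn⟩ := ((FloorSemiring.tendsto_pow_div_factorial_atTop (N * Real.pi)).eventually
    (gt_mem_nhds one_pos)).exists
  have hnorm : ‖V ^ n‖ < 1 := by
    refine lt_of_le_of_lt (ContinuousLinearMap.opNorm_le_bound _ (by positivity) fun y => ?_) hn
    refine (ContinuousMap.norm_le _ (by positivity)).2 fun x => ?_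
    refine (norm_pow_apply_le hφ n y x).trans ?_
    have := pow_le_pow_left₀ x.2.1 x.2.2 n
    rw [mul_pow, div_mul_eq_mul_div]
    refine div_le_div_of_nonneg_right ?_ (by positivity)
    calc N ^ n * ‖y‖ * (x : ℝ) ^ n ≤ N ^ n * ‖y‖ * Real.pi ^ n := by gcongr
      _ = _ := by ring
  exact isUnit_one_sub_of_norm_pow_lt_one (R := CSpace →L[ℂ] CSpace) hnorm

end Volterra

/-! ### Solutions for complex values of the spectral parameter -/

section ComplexSolutions

variable {q : ℝ → ℝ}

/-- The complex counterpart of `IsSolution`, for a complex spectral parameter, in integrated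
form: `y` and `dy` are continuous on `[0, π]`, `y` is a primitive of `dy` and `dy` is a primitive of
`(q - lam) y`. -/
structure IsCSolution (q : ℝ → ℝ) (lam : ℂ) (y dy : ℝ → ℂ) : Prop where
  cont : ContinuousOn y (Set.Icc 0 Real.pi)
  cont' : ContinuousOn dy (Set.Icc 0 Real.pi)
  eq : ∀ x ∈ Set.Icc 0 Real.pi, y x = y 0 + ∫ t in (0 : ℝ)..x, dy t
  eq' : ∀ x ∈ Set.Icc 0 Real.pi, dy x = dy 0 + ∫ t in (0 : ℝ)..x, ((q t : ℂ) - lam) * y t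

theorem intervalIntegrable_potential (hq : IntervalIntegrable q volume 0 Real.pi) (lam : ℂ) :
    IntervalIntegrable (fun t => (q t : ℂ) - lam) volume 0 Real.pi := by
  refine IntervalIntegrable.sub ?_ intervalIntegrable_const
  exact ⟨hq.1.ofReal, hq.2.ofReal⟩

theorem intervalIntegrable_mul_of_continuousOn {φ y : ℝ → ℂ}
    (hφ : IntervalIntegrable φ volume 0 Real.pi) (hy : ContinuousOn y (Set.Icc 0 Real.pi)) :
    IntervalIntegrable (fun t => φ t * y t) volume 0 Real.pi :=
  hφ.mul_continuousOn (by rwa [Set.uIcc_of_le Real.pi_pos.le])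

theorem intervalIntegrable_of_continuousOn {y : ℝ → ℂ} (hy : ContinuousOn y (Set.Icc 0 Real.pi)) :
    IntervalIntegrable y volume 0 Real.pi :=
  ContinuousOn.intervalIntegrable (by rwa [Set.uIcc_of_le Real.pi_pos.le])

theorem IsCSolution.sub_smul (hq : IntervalIntegrable q volume 0 Real.pi) {lam : ℂ}
    {y dy z dz : ℝ → ℂ} (h : IsCSolution q lam y dy) (k : IsCSolution q lam z dz) (c : ℂ) :
    IsCSolution q lam (fun x => y x - c * z x) (fun x => dy x - c * dz x) where
  cont := h.cont.sub (continuousOn_const.mul k.cont)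
  cont' := h.cont'.sub (continuousOn_const.mul k.cont')
  eq x hx := by
    rw [intervalIntegral.integral_sub
      (intervalIntegrable_sub (intervalIntegrable_of_continuousOn h.cont') zero_mem hx)
      (intervalIntegrable_sub (intervalIntegrable_of_continuousOn k.cont') zero_mem hx |>.const_mul c),
      intervalIntegral.integral_const_mul, h.eq x hx, k.eq x hx]
    ring
  eq' x hx := by
    have hp := intervalIntegrable_potential hq lam
    have e : ∀ t, ((q t : ℂ) - lam) * (y t - c * z t) =
        ((q t : ℂ) - lam) * y t - c * (((q t : ℂ) - lam) * z t) := fun t => by ring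
    simp_rw [e]
    rw [intervalIntegral.integral_sub
      (intervalIntegrable_sub (intervalIntegrable_mul_of_continuousOn hp h.cont) zero_mem hx)
      ((intervalIntegrable_sub (intervalIntegrable_mul_of_continuousOn hp k.cont)
        zero_mem hx).const_mul c),
      intervalIntegral.integral_const_mul, h.eq' x hx, k.eq' x hx]
    ring

/-- Uniqueness for the Cauchy problem at `0`. -/
theorem IsCSolution.eq_zero (hq : IntervalIntegrable q volume 0 Real.pi) {lam : ℂ}
    {y dy : ℝ → ℂ} (h : IsCSolution q lam y dy) (h0 : y 0 = 0) (h0' : dy 0 = 0) :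
    ∀ x ∈ Set.Icc 0 Real.pi, y x = 0 ∧ dy x = 0 := by
  have hp := intervalIntegrable_potential hq lam
  let Y : CSpace := ⟨(Set.Icc 0 Real.pi).domRestrict y, h.cont.domRestrict⟩
  have hY : ∀ t ∈ Set.Icc 0 Real.pi, ext Y t = y t := fun t ht => ext_of_mem Y ht
  have hdY : ∀ t ∈ Set.Icc 0 Real.pi, ext (volterra _ hp Y) t = dy t := by
    intro t ht
    rw [ext_of_mem _ ht, volterra_apply, h.eq' t ht, h0', zero_add]
    refine intervalIntegral.integral_congr fun s hs => ?_
    rw [Set.uIcc_of_le ht.1] at hs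
    rw [hY s ⟨hs.1, hs.2.trans ht.2⟩]
  have hfix : (1 - integ * volterra _ hp) Y = 0 := by
    ext x
    have : (1 - integ * volterra _ hp) Y x = Y x - integ (volterra _ hp Y) x := rfl
    rw [this, integ_apply]
    have e : Y x = y x := rfl
    rw [e, h.eq x x.2, h0, zero_add, ContinuousMap.zero_apply, sub_eq_zero]
    refine intervalIntegral.integral_congr fun s hs => ?_
    rw [Set.uIcc_of_le x.2.1] at hs
    exact (hdY s ⟨hs.1, hs.2.trans x.2.2⟩).symm
  obtain ⟨u, hu⟩ := isUnit_one_sub_integ_mul_volterra hp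
  have hY0 : Y = 0 := by
    have : ((↑u⁻¹ : CSpace →L[ℂ] CSpace) * (1 - integ * volterra _ hp)) Y = 0 := by
      rw [mul_apply_eq_comp, hfix, map_zero]
    rw [← hu, u.inv_mul] at this
    exact this
  have hy0 : ∀ t ∈ Set.Icc 0 Real.pi, y t = 0 := fun t ht => by
    rw [← hY t ht, hY0]; rfl
  refine fun x hx => ⟨hy0 x hx, ?_⟩
  rw [← hdY x hx, hY0, map_zero]
  rfl

theorem IsCSolution.eq_smul (hq : IntervalIntegrable q volume 0 Real.pi) {lam : ℂ}
    {y dy z dz : ℝ → ℂ} (h : IsCSolution q lam y dy) (k : IsCSolution q lam z dz) (c : ℂ)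
    (h0 : y 0 = c * z 0) (h0' : dy 0 = c * dz 0) :
    ∀ x ∈ Set.Icc 0 Real.pi, y x = c * z x ∧ dy x = c * dz x := by
  intro x hx
  have := (h.sub_smul hq k c).eq_zero hq (sub_eq_zero.2 h0) (sub_eq_zero.2 h0') x hx
  exact ⟨sub_eq_zero.1 this.1, sub_eq_zero.1 this.2⟩

/-- Reflecting the interval turns Cauchy data at `π` into Cauchy data at `0`. -/
theorem IsCSolution.reflect (hq : IntervalIntegrable q volume 0 Real.pi) {lam : ℂ}
    {y dy : ℝ → ℂ} (h : IsCSolution q lam y dy) :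
    IsCSolution (fun x => q (Real.pi - x)) lam (fun x => y (Real.pi - x))
      (fun x => -dy (Real.pi - x)) := by
  have hmaps : Set.MapsTo (fun x => Real.pi - x) (Set.Icc 0 Real.pi) (Set.Icc 0 Real.pi) :=
    fun x hx => ⟨by simpa using hx.2, by simpa using hx.1⟩
  have hc : ContinuousOn (fun x => Real.pi - x) (Set.Icc 0 Real.pi) := by fun_prop
  have key : ∀ {f F : ℝ → ℂ}, IntervalIntegrable f volume 0 Real.pi →
      (∀ x ∈ Set.Icc 0 Real.pi, F x = F 0 + ∫ t in (0 : ℝ)..x, f t) → ∀ x ∈ Set.Icc 0 Real.pi,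
      F (Real.pi - x) = F (Real.pi - 0) - ∫ t in (0 : ℝ)..x, f (Real.pi - t) := by
    intro f F hf hF x hx
    rw [intervalIntegral.integral_comp_sub_left, sub_zero, hF _ (hmaps hx), hF _ pi_mem,
      ← intervalIntegral.integral_add_adjacent_intervals
        (intervalIntegrable_sub hf zero_mem (hmaps hx))
        (intervalIntegrable_sub hf (hmaps hx) pi_mem)]
    ring
  refine ⟨h.cont.comp hc hmaps, (h.cont'.comp hc hmaps).neg, fun x hx => ?_, fun x hx => ?_⟩
  · rw [key (intervalIntegrable_of_continuousOn h.cont') h.eq x hx, intervalIntegral.integral_neg]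
    ring
  · rw [key (intervalIntegrable_mul_of_continuousOn (intervalIntegrable_potential hq lam) h.cont)
      h.eq' x hx]
    ring

/-- A solution whose Cauchy data at `π` vanish is trivial. -/
theorem IsCSolution.deriv_zero_eq_zero (hq : IntervalIntegrable q volume 0 Real.pi) {lam : ℂ}
    {y dy : ℝ → ℂ} (h : IsCSolution q lam y dy) (hπ : y Real.pi = 0) (hπ' : dy Real.pi = 0) :
    dy 0 = 0 := by
  have hq' : IntervalIntegrable (fun x => q (Real.pi - x)) volume 0 Real.pi := by
    have := (hq.comp_sub_left Real.pi).symm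
    simpa using this
  have := (h.reflect hq).eq_zero hq' (by simpa using hπ) (by simpa using hπ') Real.pi pi_mem
  simpa using this.2

/-- The identity function on `[0, π]`, with complex values. -/
noncomputable def idC : CSpace := ⟨fun x => ((x : ℝ) : ℂ), by fun_prop⟩

/-- `S(·, lam)` for complex `lam`, obtained by inverting the Volterra integral equation
`S = x + ∫∫ (q - lam) S`. -/
noncomputable def solC (hq : IntervalIntegrable q volume 0 Real.pi) (lam : ℂ) : CSpace :=
  (Ring.inverse (1 - integ * volterra _ (intervalIntegrable_potential hq lam)) :
    CSpace →L[ℂ] CSpace) idC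

/-- `S'(·, lam)` for complex `lam`. -/
noncomputable def dsolC (hq : IntervalIntegrable q volume 0 Real.pi) (lam : ℂ) : CSpace :=
  1 + volterra _ (intervalIntegrable_potential hq lam) (solC hq lam)

theorem solC_eq (hq : IntervalIntegrable q volume 0 Real.pi) (lam : ℂ) :
    solC hq lam = integ (dsolC hq lam) := by
  have hp := intervalIntegrable_potential hq lam
  have h1 : (1 - integ * volterra _ hp) (solC hq lam) = idC := by
    have := Ring.mul_inverse_cancel _ (isUnit_one_sub_integ_mul_volterra hp)
    exact DFunLike.congr_fun this idC
  have h2 : integ (1 : CSpace) = idC := by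
    ext x
    rw [integ_apply]
    have : ∀ t, ext (1 : CSpace) t = 1 := fun t => rfl
    simp [this, idC]
  rw [dsolC, map_add, h2, ← h1]
  have : (1 - integ * volterra _ hp) (solC hq lam) =
    solC hq lam - integ (volterra _ hp (solC hq lam)) := rfl
  rw [this]
  abel

theorem isCSolution_solC (hq : IntervalIntegrable q volume 0 Real.pi) (lam : ℂ) :
    IsCSolution q lam (ext (solC hq lam)) (ext (dsolC hq lam)) := by
  have hp := intervalIntegrable_potential hq lam
  refine ⟨(continuous_ext _).continuousOn, (continuous_ext _).continuousOn,
    fun x hx => ?_, fun x hx => ?_⟩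
  · rw [ext_of_mem _ hx, ext_of_mem _ zero_mem, solC_eq, integ_apply, integ_apply]
    simp
  · rw [ext_of_mem _ hx, ext_of_mem _ zero_mem]
    have : ∀ z, dsolC hq lam z = 1 + volterra _ hp (solC hq lam) z := fun z => rfl
    rw [this, this, volterra_apply, volterra_apply]
    simp

theorem ext_solC_zero (hq : IntervalIntegrable q volume 0 Real.pi) (lam : ℂ) :
    ext (solC hq lam) 0 = 0 := by
  rw [ext_of_mem _ zero_mem, solC_eq, integ_apply]
  simp

theorem ext_dsolC_zero (hq : IntervalIntegrable q volume 0 Real.pi) (lam : ℂ) :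
    ext (dsolC hq lam) 0 = 1 := by
  have hp := intervalIntegrable_potential hq lam
  rw [ext_of_mem _ zero_mem]
  have : ∀ z, dsolC hq lam z = 1 + volterra _ hp (solC hq lam) z := fun z => rfl
  rw [this, volterra_apply]
  simp

theorem volterra_sub_smul (hq : IntervalIntegrable q volume 0 Real.pi) (lam : ℂ) :
    volterra _ (intervalIntegrable_potential hq lam) =
      volterra _ (intervalIntegrable_potential hq 0) - lam • integ := by
  ext y x
  have : (volterra _ (intervalIntegrable_potential hq 0) - lam • integ) y x =
    volterra _ (intervalIntegrable_potential hq 0) y x - lam * integ y x := rfl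
  rw [this, volterra_apply, volterra_apply, integ_apply, ← intervalIntegral.integral_const_mul,
    ← intervalIntegral.integral_sub
      (intervalIntegrable_sub (intervalIntegrable_mul_ext (intervalIntegrable_potential hq 0) y)
        zero_mem x.2) ((continuous_ext y).intervalIntegrable _ _ |>.const_mul lam)]
  refine intervalIntegral.integral_congr fun t _ => ?_
  ring

theorem differentiable_toSpanSingleton {E : Type*} [NormedAddCommGroup E] [NormedSpace ℂ E]
    (a : E) : Differentiable ℂ fun z : ℂ => z • a :=
  differentiable_id.smul_const a

theorem differentiableAt_inverse_one_sub_mul {R : Type*} [NormedRing R] [NormedAlgebra ℂ R]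
    [HasSummableGeomSeries R] {F : ℂ → R} {z : ℂ} (a : R) (hF : DifferentiableAt ℂ F z)
    (hu : IsUnit (1 - a * F z)) : DifferentiableAt ℂ (fun z => Ring.inverse (1 - a * F z)) z :=
  DifferentiableAt.comp (g := Ring.inverse) z (differentiableAt_inverse (𝕜 := ℂ) hu)
    ((hF.const_mul a).const_sub 1)

theorem differentiable_volterra (hq : IntervalIntegrable q volume 0 Real.pi) :
    Differentiable ℂ fun lam => volterra _ (intervalIntegrable_potential hq lam) := by
  have : (fun lam => volterra _ (intervalIntegrable_potential hq lam)) =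
      fun lam : ℂ => volterra _ (intervalIntegrable_potential hq 0) - lam • integ :=
    funext fun lam => volterra_sub_smul hq lam
  rw [this]
  exact (differentiable_const _).sub (differentiable_toSpanSingleton integ)

theorem differentiable_solC (hq : IntervalIntegrable q volume 0 Real.pi) :
    Differentiable ℂ (solC hq) := by
  intro lam
  have hu := isUnit_one_sub_integ_mul_volterra (intervalIntegrable_potential hq lam)
  have h2 : DifferentiableAt ℂ (fun lam => (Ring.inverse ((1 : CSpace →L[ℂ] CSpace) -
      integ * volterra _ (intervalIntegrable_potential hq lam)))) lam :=
    differentiableAt_inverse_one_sub_mul (R := CSpace →L[ℂ] CSpace) integ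
      ((differentiable_volterra hq) lam) hu
  exact h2.clm_apply (differentiableAt_const idC)

theorem differentiable_dsolC (hq : IntervalIntegrable q volume 0 Real.pi) :
    Differentiable ℂ (dsolC hq) :=
  ((differentiable_volterra hq).clm_apply (differentiable_solC hq)).const_add 1

/-- The entire function `S(π, ·)`. -/
noncomputable def sC (hq : IntervalIntegrable q volume 0 Real.pi) (lam : ℂ) : ℂ :=
  solC hq lam ⟨Real.pi, pi_mem⟩

/-- The entire function `S'(π, ·)`. -/
noncomputable def dsC (hq : IntervalIntegrable q volume 0 Real.pi) (lam : ℂ) : ℂ :=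
  dsolC hq lam ⟨Real.pi, pi_mem⟩

theorem differentiable_sC (hq : IntervalIntegrable q volume 0 Real.pi) :
    Differentiable ℂ (sC hq) :=
  let e : CSpace →L[ℂ] ℂ := ContinuousMap.evalCLM ℂ ⟨Real.pi, pi_mem⟩
  e.differentiable.comp (differentiable_solC hq)

theorem differentiable_dsC (hq : IntervalIntegrable q volume 0 Real.pi) :
    Differentiable ℂ (dsC hq) :=
  let e : CSpace →L[ℂ] ℂ := ContinuousMap.evalCLM ℂ ⟨Real.pi, pi_mem⟩
  e.differentiable.comp (differentiable_dsolC hq)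

/-- `S(π, ·)` and `S'(π, ·)` have no common zeros. -/
theorem sC_or_dsC_ne_zero (hq : IntervalIntegrable q volume 0 Real.pi) (lam : ℂ) :
    sC hq lam ≠ 0 ∨ dsC hq lam ≠ 0 := by
  by_contra! h
  have := (isCSolution_solC hq lam).deriv_zero_eq_zero hq
    (by rw [ext_of_mem _ pi_mem]; exact h.1) (by rw [ext_of_mem _ pi_mem]; exact h.2)
  rw [ext_dsolC_zero] at this
  exact one_ne_zero this

end ComplexSolutions

/-! ### Real solutions and eigenvalues -/

section RealSolutions

variable {q : ℝ → ℝ}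

theorem IsSolution.isCSolution (hq : IntervalIntegrable q volume 0 Real.pi) {lam : ℝ}
    {y dy : ℝ → ℝ} (h : IsSolution q lam y dy) :
    IsCSolution q lam (fun x => (y x : ℂ)) (fun x => (dy x : ℂ)) := by
  have hy : ContinuousOn y (Set.Icc 0 Real.pi) := fun x hx => (h.1 x hx).continuousWithinAt
  have hint : IntervalIntegrable (fun t => (q t - lam) * y t) volume 0 Real.pi :=
    (hq.sub intervalIntegrable_const).mul_continuousOn (by rwa [Set.uIcc_of_le Real.pi_pos.le])
  have hdy : ContinuousOn dy (Set.Icc 0 Real.pi) := by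
    have h1 := intervalIntegral.continuousOn_primitive_interval' hint Set.left_mem_uIcc
    rw [Set.uIcc_of_le Real.pi_pos.le] at h1
    exact (continuousOn_const.add h1).congr h.2
  refine ⟨Complex.continuous_ofReal.comp_continuousOn hy,
    Complex.continuous_ofReal.comp_continuousOn hdy, fun x hx => ?_, fun x hx => ?_⟩
  · have hsub : Set.Icc 0 x ⊆ Set.Icc 0 Real.pi := Set.Icc_subset_Icc_right hx.2
    have := intervalIntegral.integral_eq_sub_of_hasDerivAt_of_le hx.1 (hy.mono hsub)
      (fun t ht => (h.1 t ⟨ht.1.le, ht.2.le.trans hx.2⟩).hasDerivAt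
        (Icc_mem_nhds ht.1 (ht.2.trans_le hx.2)))
      (ContinuousOn.intervalIntegrable (by rw [Set.uIcc_of_le hx.1]; exact hdy.mono hsub))
    rw [intervalIntegral.integral_ofReal, this]
    push_cast
    ring
  · have : ∀ t, ((q t : ℂ) - lam) * (y t : ℂ) = (((q t - lam) * y t : ℝ) : ℂ) := fun t => by
      push_cast; ring
    simp_rw [this]
    rw [intervalIntegral.integral_ofReal, h.2 x hx]
    push_cast
    ring

/-- For real `lam` the real part of the complex solution solves the real problem, so the value chosen
in `sineSolution` is a genuine solution. -/
theorem isSolution_re (hq : IntervalIntegrable q volume 0 Real.pi) (lam : ℝ) :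
    IsSolution q lam (fun x => (ext (solC hq lam) x).re) (fun x => (ext (dsolC hq lam) x).re) := by
  have h := isCSolution_solC hq (lam : ℂ)
  have hre : ∀ {f : ℝ → ℂ} {a b : ℝ}, IntervalIntegrable f volume a b →
      (∫ t in a..b, f t).re = ∫ t in a..b, (f t).re := fun hf =>
    (Complex.reCLM.intervalIntegral_comp_comm hf).symm
  refine ⟨fun x hx => ?_, fun x hx => ?_⟩
  · have hc : Continuous fun t => (ext (dsolC hq lam) t).re :=
      Complex.continuous_re.comp (continuous_ext _)
    have h1 : HasDerivAt (fun x => (ext (solC hq lam) 0).re +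
        ∫ t in (0 : ℝ)..x, (ext (dsolC hq lam) t).re) (ext (dsolC hq lam) x).re x :=
      (intervalIntegral.integral_hasDerivAt_right (hc.intervalIntegrable _ _)
        (hc.stronglyMeasurableAtFilter _ _) hc.continuousAt).const_add _
    refine h1.hasDerivWithinAt.congr_of_mem (fun t ht => ?_) hx
    rw [h.eq t ht, Complex.add_re, hre ((continuous_ext _).intervalIntegrable _ _)]
  · simp only
    rw [h.eq' x hx, Complex.add_re, hre (intervalIntegrable_sub (intervalIntegrable_mul_ext
      (intervalIntegrable_potential hq lam) _) zero_mem hx)]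
    congr 1
    refine intervalIntegral.integral_congr fun t _ => ?_
    simp [Complex.mul_re]

theorem sineSolution_spec (hq : IntervalIntegrable q volume 0 Real.pi) (lam : ℝ) :
    IsSolution q lam (sineSolution q lam).1 (sineSolution q lam).2 ∧
      (sineSolution q lam).1 0 = 0 ∧ (sineSolution q lam).2 0 = 1 := by
  refine Classical.epsilon_spec (p := fun s : (ℝ → ℝ) × (ℝ → ℝ) =>
    IsSolution q lam s.1 s.2 ∧ s.1 0 = 0 ∧ s.2 0 = 1)
    ⟨(fun x => (ext (solC hq lam) x).re, fun x => (ext (dsolC hq lam) x).re),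
      isSolution_re hq lam, ?_, ?_⟩
  · simp only [ext_solC_zero, Complex.zero_re]
  · simp only [ext_dsolC_zero, Complex.one_re]

theorem IsSolution.eq_smul_sineSolution (hq : IntervalIntegrable q volume 0 Real.pi) {lam : ℝ}
    {y dy : ℝ → ℝ} (h : IsSolution q lam y dy) (h0 : y 0 = 0) :
    ∀ x ∈ Set.Icc 0 Real.pi, y x = dy 0 * (sineSolution q lam).1 x ∧
      dy x = dy 0 * (sineSolution q lam).2 x := by
  obtain ⟨hs, hs0, hs0'⟩ := sineSolution_spec hq lam
  intro x hx
  have := (h.isCSolution hq).eq_smul hq (hs.isCSolution hq) (dy 0) (by simp [h0, hs0])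
    (by simp [hs0']) x hx
  exact_mod_cast this

theorem sC_ofReal (hq : IntervalIntegrable q volume 0 Real.pi) (lam : ℝ) :
    sC hq lam = (SPi q lam : ℂ) ∧ dsC hq lam = (dSPi q lam : ℂ) := by
  obtain ⟨hs, hs0, hs0'⟩ := sineSolution_spec hq lam
  have := (isCSolution_solC hq lam).eq_smul hq (hs.isCSolution hq) 1
    (by rw [ext_solC_zero]; simp [hs0]) (by rw [ext_dsolC_zero]; simp [hs0']) Real.pi pi_mem
  rw [ext_of_mem _ pi_mem, ext_of_mem _ pi_mem, one_mul, one_mul] at this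
  exact this

/-- At an eigenvalue where no `S_j(π, lam)` vanishes, `∑ S_j'/S_j = 0`, so the sum `g` over the
edges `2, …, m` is determined by the first edge. -/
theorem g_eq_of_isEigenvalue {m : ℕ} (hm : 1 ≤ m) {q : ℕ → ℝ → ℝ}
    (hq : ∀ j ∈ Finset.Icc 1 m, IntervalIntegrable (q j) volume 0 Real.pi) {lam : ℝ}
    (hlam : IsEigenvalue m q lam) (hS : ∀ j ∈ Finset.Icc 1 m, SPi (q j) lam ≠ 0) :
    g m q lam = -(dSPi (q 1) lam / SPi (q 1) lam) := by
  obtain ⟨y, dy, hsol, h0, hcont, hkirch, j₀, hj₀, x₀, hx₀, hne⟩ := hlam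
  have h1 : 1 ∈ Finset.Icc 1 m := Finset.mem_Icc.2 ⟨le_rfl, hm⟩
  have hform := fun j hj => (hsol j hj).eq_smul_sineSolution (hq j hj) (h0 j hj)
  have hπ : ∀ j ∈ Finset.Icc 1 m, y 1 Real.pi = dy j 0 * SPi (q j) lam := by
    intro j hj
    rw [SPi, ← (hform j hj Real.pi pi_mem).1]
    rcases eq_or_ne j 1 with rfl | hj1
    · rfl
    · exact hcont j (Finset.mem_Icc.2 ⟨by have := (Finset.mem_Icc.1 hj).1; omega,
        (Finset.mem_Icc.1 hj).2⟩)
  have hd : y 1 Real.pi ≠ 0 := by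
    intro h
    have hz : dy j₀ 0 = 0 := by
      have := hπ j₀ hj₀
      rw [h] at this
      exact (mul_eq_zero.1 this.symm).resolve_right (hS j₀ hj₀)
    apply hne
    rw [(hform j₀ hj₀ x₀ hx₀).1, hz, zero_mul]
  have hsum : ∑ j ∈ Finset.Icc 1 m, dSPi (q j) lam / SPi (q j) lam = 0 := by
    refine (mul_eq_zero.1 ?_).resolve_left hd
    rw [Finset.mul_sum, ← hkirch]
    refine Finset.sum_congr rfl fun j hj => ?_
    rw [(hform j hj Real.pi pi_mem).2, hπ j hj, dSPi]
    have := hS j hj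
    field_simp
  have hsplit : Finset.Icc 1 m = insert 1 (Finset.Icc 2 m) := by
    ext j; simp only [Finset.mem_Icc, Finset.mem_insert]; omega
  rw [hsplit, Finset.sum_insert (by simp)] at hsum
  simp only [g, weyl, Finset.sum_neg_distrib, neg_neg]
  linarith

end RealSolutions

/-! ### Asymptotics of the characteristic functions -/

section Asymptotics

theorem absolutelyContinuous_congr {f g : ℝ → ℂ} {a b : ℝ}
    (hf : AbsolutelyContinuousOnInterval f a b) (h : ∀ x ∈ Set.uIcc a b, g x = f x) :
    AbsolutelyContinuousOnInterval g a b := by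
  rw [absolutelyContinuousOnInterval_iff] at hf ⊢
  intro ε hε
  obtain ⟨δ, hδ, H⟩ := hf ε hε
  refine ⟨δ, hδ, fun E hE hlt => ?_⟩
  have := H E hE hlt
  rwa [Finset.sum_congr rfl fun i hi => by
    rw [h _ (hE.1 i hi).1, h _ (hE.1 i hi).2]]

theorem absolutelyContinuous_primitive {f : ℝ → ℂ} (hf : IntervalIntegrable f volume 0 Real.pi) :
    AbsolutelyContinuousOnInterval (fun x => ∫ t in (0 : ℝ)..x, f t) 0 Real.pi := by
  have h1 : IntervalIntegrable (fun t => (f t).re) volume 0 Real.pi := ⟨hf.1.re, hf.2.re⟩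
  have h2 : IntervalIntegrable (fun t => (f t).im) volume 0 Real.pi := ⟨hf.1.im, hf.2.im⟩
  have hc : ∀ c : ℂ, AbsolutelyContinuousOnInterval (fun _ : ℝ => c) 0 Real.pi := fun c =>
    contDiffOn_const.absolutelyContinuousOnInterval
  have a1 := (h1.absolutelyContinuousOnInterval_intervalIntegral Set.left_mem_uIcc).smul (hc 1)
  have a2 := (h2.absolutelyContinuousOnInterval_intervalIntegral Set.left_mem_uIcc).smul
    (hc Complex.I)
  refine absolutelyContinuous_congr (a1.add a2) fun x hx => ?_
  rw [Set.uIcc_of_le Real.pi_pos.le] at hx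
  have hx' := intervalIntegrable_sub hf zero_mem hx
  have e1 : (∫ t in (0 : ℝ)..x, f t).re = ∫ t in (0 : ℝ)..x, (f t).re :=
    (Complex.reCLM.intervalIntegral_comp_comm hx').symm
  have e2 : (∫ t in (0 : ℝ)..x, f t).im = ∫ t in (0 : ℝ)..x, (f t).im :=
    (Complex.imCLM.intervalIntegral_comp_comm hx').symm
  simp only [Pi.add_apply, Pi.smul_apply', ← e1, ← e2, Complex.real_smul, mul_one]
  exact (Complex.re_add_im _).symm

/-- Integrating factor: the solution of `u' = c u + f`, with `f` integrable, is given by Duhamel's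
formula. -/
theorem eq_exp_mul_of_integral_eq {u f : ℝ → ℂ} {c : ℂ}
    (hu : ContinuousOn u (Set.Icc 0 Real.pi)) (hf : IntervalIntegrable f volume 0 Real.pi)
    (h : ∀ x ∈ Set.Icc 0 Real.pi, u x = u 0 + ∫ t in (0 : ℝ)..x, (c * u t + f t)) :
    ∀ x ∈ Set.Icc 0 Real.pi,
      u x = Complex.exp (c * x) * u 0 + ∫ t in (0 : ℝ)..x, Complex.exp (c * (x - t)) * f t := by
  have hw : IntervalIntegrable (fun t => c * u t + f t) volume 0 Real.pi :=
    ((intervalIntegrable_of_continuousOn hu).const_mul c).add hf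
  have hE : ∀ x : ℝ, HasDerivAt (fun x : ℝ => Complex.exp (-c * x)) (-c * Complex.exp (-c * x)) x := by
    intro x
    have h1 : HasDerivAt (fun x : ℝ => -c * (x : ℂ)) (-c) x := by
      simpa using (Complex.ofRealCLM.hasDerivAt (x := x)).const_mul (-c)
    simpa [mul_comm] using h1.cexp
  have hEc : Continuous fun x : ℝ => Complex.exp (-c * x) := by fun_prop
  have hEf : IntervalIntegrable (fun t => Complex.exp (-c * t) * f t) volume 0 Real.pi :=
    hf.continuousOn_mul hEc.continuousOn
  have acE : AbsolutelyContinuousOnInterval (fun x : ℝ => Complex.exp (-c * x)) 0 Real.pi := by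
    refine ContDiffOn.absolutelyContinuousOnInterval (ContDiff.contDiffOn ?_)
    exact Complex.contDiff_exp.comp (contDiff_const.mul Complex.ofRealCLM.contDiff)
  have acU : AbsolutelyContinuousOnInterval
      (fun x : ℝ => u 0 + ∫ t in (0 : ℝ)..x, (c * u t + f t)) 0 Real.pi :=
    (contDiffOn_const.absolutelyContinuousOnInterval).add (absolutelyContinuous_primitive hw)
  have ac := (acE.smul acU).sub (absolutelyContinuous_primitive hEf)
  obtain ⟨C, hC⟩ := ac.const_of_ae_hasDerivAt_zero (by
    filter_upwards [hw.ae_hasDerivAt_integral, hEf.ae_hasDerivAt_integral] with x h1 h2 hx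
    have hx' : x ∈ Set.Icc 0 Real.pi := by rwa [Set.uIcc_of_le Real.pi_pos.le] at hx
    have d1 := (h1 hx 0 Set.left_mem_uIcc).const_add (u 0)
    have d2 := h2 hx 0 Set.left_mem_uIcc
    have := ((hE x).mul d1).sub d2
    rw [← h x hx'] at this
    convert! this using 1
    ring)
  rw [Set.uIcc_of_le Real.pi_pos.le] at hC
  have hC0 : C = u 0 := by
    rw [← hC 0 zero_mem]
    simp
  intro x hx
  have h1 := hC x hx
  simp only [Pi.sub_apply, smul_eq_mul, Pi.mul_apply] at h1
  rw [← h x hx, hC0, sub_eq_iff_eq_add] at h1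
  have h2 : Complex.exp (c * x) * Complex.exp (-c * x) = 1 := by
    rw [← Complex.exp_add]
    simp
  have h3 : ∀ t : ℝ, Complex.exp (c * (x - t)) * f t =
      Complex.exp (c * x) * (Complex.exp (-c * t) * f t) := by
    intro t
    rw [← mul_assoc, ← Complex.exp_add]
    ring_nf
  simp_rw [h3]
  rw [intervalIntegral.integral_const_mul, ← mul_add, ← h1, ← mul_assoc, h2, one_mul]

theorem norm_exp_le {σ : ℂ} {τ x : ℝ} (hσ : |σ.re| ≤ τ) (hx : 0 ≤ x) :
    ‖Complex.exp (σ * x)‖ ≤ Real.exp (τ * x) := by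
  rw [Complex.norm_exp]
  refine Real.exp_le_exp.2 ?_
  simp only [Complex.mul_re, Complex.ofReal_re, Complex.ofReal_im, mul_zero, sub_zero]
  exact mul_le_mul_of_nonneg_right ((le_abs_self _).trans hσ) hx

theorem norm_sin_le (z : ℂ) : ‖Complex.sin z‖ ≤ Real.exp |z.im| := by
  have h1 := norm_exp_le (σ := -Complex.I * z) (τ := |z.im|) (x := 1) (by simp) zero_le_one
  have h2 := norm_exp_le (σ := Complex.I * z) (τ := |z.im|) (x := 1) (by simp) zero_le_one
  simp only [Complex.ofReal_one, mul_one] at h1 h2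
  have e : Complex.sin z = (Complex.exp (-Complex.I * z) - Complex.exp (Complex.I * z)) *
      Complex.I / 2 := by
    rw [Complex.sin]; ring_nf
  rw [e, norm_div, norm_mul, Complex.norm_I, mul_one, Complex.norm_ofNat]
  linarith [norm_sub_le (Complex.exp (-Complex.I * z)) (Complex.exp (Complex.I * z))]

theorem norm_cos_le (z : ℂ) : ‖Complex.cos z‖ ≤ Real.exp |z.im| := by
  have h1 := norm_exp_le (σ := -Complex.I * z) (τ := |z.im|) (x := 1) (by simp) zero_le_one
  have h2 := norm_exp_le (σ := Complex.I * z) (τ := |z.im|) (x := 1) (by simp) zero_le_one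
  simp only [Complex.ofReal_one, mul_one] at h1 h2
  have e : Complex.cos z = (Complex.exp (Complex.I * z) + Complex.exp (-Complex.I * z)) / 2 := by
    rw [Complex.cos]; ring_nf
  rw [e, norm_div, Complex.norm_ofNat]
  linarith [norm_add_le (Complex.exp (Complex.I * z)) (Complex.exp (-Complex.I * z))]

variable {q : ℝ → ℝ}

/-- The `L₁` norm `‖f‖₁` on `(0, π)`, used for potentials and for transformed functions. -/
noncomputable def l1Norm (f : ℝ → ℝ) : ℝ := ∫ t in (0 : ℝ)..Real.pi, ‖f t‖

theorem l1Norm_nonneg : 0 ≤ l1Norm q :=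
  intervalIntegral.integral_nonneg Real.pi_pos.le fun _ _ => norm_nonneg _

/-- Duhamel's formula for `S' + σ S`, where `σ = ± i ρ`. -/
theorem dsolC_add_mul_solC (hq : IntervalIntegrable q volume 0 Real.pi) {ρ σ : ℂ}
    (hσ : σ ^ 2 = -ρ ^ 2) {x : ℝ} (hx : x ∈ Set.Icc 0 Real.pi) :
    ext (dsolC hq (ρ ^ 2)) x + σ * ext (solC hq (ρ ^ 2)) x =
      Complex.exp (σ * x) +
        ∫ t in (0 : ℝ)..x, Complex.exp (σ * (x - t)) * (q t * ext (solC hq (ρ ^ 2)) t) := by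
  have h := isCSolution_solC hq (ρ ^ 2)
  have hqy : IntervalIntegrable (fun t => (q t : ℂ) * ext (solC hq (ρ ^ 2)) t) volume 0 Real.pi :=
    intervalIntegrable_mul_ext ⟨hq.1.ofReal, hq.2.ofReal⟩ _
  have key := eq_exp_mul_of_integral_eq
    (u := fun x => ext (dsolC hq (ρ ^ 2)) x + σ * ext (solC hq (ρ ^ 2)) x) (c := σ)
    (h.cont'.add (continuousOn_const.mul h.cont)) hqy (fun x hx => by
      have hi := intervalIntegrable_sub (intervalIntegrable_mul_of_continuousOn
        (intervalIntegrable_potential hq (ρ ^ 2)) h.cont) zero_mem hx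
      have hi' := ((continuous_ext (dsolC hq (ρ ^ 2))).intervalIntegrable (μ := volume) 0 x).const_mul σ
      rw [h.eq' x hx, h.eq x hx, mul_add, ← intervalIntegral.integral_const_mul, add_add_add_comm]
      congr 1
      rw [← intervalIntegral.integral_add hi hi']
      refine intervalIntegral.integral_congr fun t _ => ?_
      linear_combination (-ext (solC hq (ρ ^ 2)) t) * hσ) x hx
  rw [key, ext_solC_zero, ext_dsolC_zero]
  simp

/-- The integral term in Duhamel's formula is controlled by a weighted bound for `y`. -/
theorem norm_duhamel_le (hq : IntervalIntegrable q volume 0 Real.pi) {y : ℝ → ℂ} {σ : ℂ}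
    {τ W x : ℝ} (hσ : |σ.re| ≤ τ) (hx : x ∈ Set.Icc 0 Real.pi)
    (hy : ∀ t ∈ Set.Icc 0 Real.pi, ‖y t‖ ≤ W * Real.exp (τ * t)) (hW : 0 ≤ W) :
    ‖∫ t in (0 : ℝ)..x, Complex.exp (σ * (x - t)) * (q t * y t)‖ ≤
      l1Norm q * W * Real.exp (τ * x) := by
  have hq0 : IntervalIntegrable q volume 0 x := by
    refine hq.mono_set ?_
    rw [Set.uIcc_of_le hx.1, Set.uIcc_of_le Real.pi_pos.le]
    exact Set.Icc_subset_Icc_right hx.2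
  calc ‖∫ t in (0 : ℝ)..x, Complex.exp (σ * (x - t)) * (q t * y t)‖
      ≤ ∫ t in (0 : ℝ)..x, ‖q t‖ * (W * Real.exp (τ * x)) := by
        refine intervalIntegral.norm_integral_le_of_norm_le hx.1
          (Filter.Eventually.of_forall fun t ht => ?_) (hq0.norm.mul_const _)
        have h1 := norm_exp_le hσ (sub_nonneg.2 ht.2)
        rw [Complex.ofReal_sub] at h1
        rw [norm_mul, norm_mul, Complex.norm_real]
        calc ‖Complex.exp (σ * (x - t))‖ * (‖q t‖ * ‖y t‖)
            ≤ Real.exp (τ * (x - t)) * (‖q t‖ * (W * Real.exp (τ * t))) := by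
              gcongr
              exact hy t ⟨ht.1.le, ht.2.trans hx.2⟩
          _ = ‖q t‖ * (W * (Real.exp (τ * (x - t)) * Real.exp (τ * t))) := by ring
          _ = _ := by rw [← Real.exp_add]; ring_nf
    _ = (∫ t in (0 : ℝ)..x, ‖q t‖) * (W * Real.exp (τ * x)) :=
        intervalIntegral.integral_mul_const _ _
    _ ≤ l1Norm q * (W * Real.exp (τ * x)) :=
        mul_le_mul_of_nonneg_right (intervalIntegral.integral_mono_interval le_rfl hx.1 hx.2
          (Filter.Eventually.of_forall fun _ => norm_nonneg _) hq.norm) (by positivity)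
    _ = _ := by ring

/-- The first-order asymptotics of `ρ S` and `S'` with remainders in terms of an a priori bound for
`S`. -/
theorem norm_solC_sub_le (hq : IntervalIntegrable q volume 0 Real.pi) {ρ : ℂ} {W x : ℝ}
    (hx : x ∈ Set.Icc 0 Real.pi) (hW : 0 ≤ W)
    (hy : ∀ t ∈ Set.Icc 0 Real.pi,
      ‖ext (solC hq (ρ ^ 2)) t‖ ≤ W * Real.exp (|ρ.im| * t)) :
    ‖ρ * ext (solC hq (ρ ^ 2)) x - Complex.sin (ρ * x)‖ ≤
        l1Norm q * W * Real.exp (|ρ.im| * x) ∧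
      ‖ext (dsolC hq (ρ ^ 2)) x - Complex.cos (ρ * x)‖ ≤
        l1Norm q * W * Real.exp (|ρ.im| * x) := by
  have p1 : (Complex.I * ρ) ^ 2 = -ρ ^ 2 := by rw [mul_pow, Complex.I_sq]; ring
  have p2 : (-(Complex.I * ρ)) ^ 2 = -ρ ^ 2 := by rw [neg_sq, p1]
  have e1 := dsolC_add_mul_solC hq p1 hx
  have e2 := dsolC_add_mul_solC hq p2 hx
  have b1 := norm_duhamel_le hq (σ := Complex.I * ρ) (by simp) hx hy hW
  have b2 := norm_duhamel_le hq (σ := -(Complex.I * ρ)) (by simp) hx hy hW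
  set I1 := ∫ t in (0 : ℝ)..x, Complex.exp (Complex.I * ρ * (x - t)) *
    (q t * ext (solC hq (ρ ^ 2)) t)
  set I2 := ∫ t in (0 : ℝ)..x, Complex.exp (-(Complex.I * ρ) * (x - t)) *
    (q t * ext (solC hq (ρ ^ 2)) t)
  have a1 : Complex.exp (Complex.I * ρ * x) = Complex.cos (ρ * x) + Complex.sin (ρ * x) * Complex.I := by
    rw [← Complex.exp_mul_I]; ring_nf
  have a2 : Complex.exp (-(Complex.I * ρ) * x) =
      Complex.cos (ρ * x) - Complex.sin (ρ * x) * Complex.I := by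
    have := Complex.exp_mul_I (-(ρ * x))
    rw [Complex.cos_neg, Complex.sin_neg] at this
    rw [← neg_mul_eq_neg_mul, neg_mul, ← sub_eq_add_neg] at this
    rw [← this]; ring_nf
  rw [a1] at e1
  rw [a2] at e2
  have f1 : ρ * ext (solC hq (ρ ^ 2)) x - Complex.sin (ρ * x) = (I1 - I2) * (-Complex.I) / 2 := by
    linear_combination (-Complex.I / 2) * e1 + (Complex.I / 2) * e2 +
      (ρ * ext (solC hq (ρ ^ 2)) x - Complex.sin (ρ * x)) * Complex.I_sq
  have f2 : ext (dsolC hq (ρ ^ 2)) x - Complex.cos (ρ * x) = (I1 + I2) / 2 := by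
    linear_combination (1 / 2) * e1 + (1 / 2) * e2
  constructor
  · rw [f1, norm_div, norm_mul, norm_neg, Complex.norm_I, mul_one, Complex.norm_ofNat]
    linarith [norm_sub_le I1 I2]
  · rw [f2, norm_div, Complex.norm_ofNat]
    linarith [norm_add_le I1 I2]

/-- The a priori bound `|S(x, ρ²)| ≤ (2 / |ρ|) exp (|Im ρ| x)` for large `|ρ|`. -/
theorem norm_solC_le (hq : IntervalIntegrable q volume 0 Real.pi) {ρ : ℂ}
    (hρ : 2 * l1Norm q + 1 ≤ ‖ρ‖) {x : ℝ} (hx : x ∈ Set.Icc 0 Real.pi) :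
    ‖ext (solC hq (ρ ^ 2)) x‖ ≤ 2 / ‖ρ‖ * Real.exp (|ρ.im| * x) := by
  have hQ := l1Norm_nonneg (q := q)
  have hρ0 : 0 < ‖ρ‖ := by linarith
  -- `W` is the maximum of the weighted norm; the integral equation bounds it by `(1 + W ‖q‖₁)/|ρ|`
  obtain ⟨x₀, hx₀, hmax⟩ := isCompact_Icc.exists_isMaxOn (s := Set.Icc (0 : ℝ) Real.pi)
    ⟨0, zero_mem⟩ (f := fun x => ‖ext (solC hq (ρ ^ 2)) x‖ * Real.exp (-(|ρ.im| * x)))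
    (((continuous_ext _).norm.mul (by fun_prop)).continuousOn)
  set W := ‖ext (solC hq (ρ ^ 2)) x₀‖ * Real.exp (-(|ρ.im| * x₀)) with hWdef
  have hW : 0 ≤ W := by positivity
  have hy : ∀ t ∈ Set.Icc 0 Real.pi,
      ‖ext (solC hq (ρ ^ 2)) t‖ ≤ W * Real.exp (|ρ.im| * t) := by
    intro t ht
    have : ‖ext (solC hq (ρ ^ 2)) t‖ * Real.exp (-(|ρ.im| * t)) ≤ W := hmax ht
    calc ‖ext (solC hq (ρ ^ 2)) t‖ = ‖ext (solC hq (ρ ^ 2)) t‖ * Real.exp (-(|ρ.im| * t)) *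
        Real.exp (|ρ.im| * t) := by rw [mul_assoc, ← Real.exp_add]; simp
      _ ≤ _ := mul_le_mul_of_nonneg_right this (Real.exp_pos _).le
  have h1 := (norm_solC_sub_le hq hx₀ hW hy).1
  have h2 : ‖Complex.sin (ρ * x₀)‖ ≤ Real.exp (|ρ.im| * x₀) := by
    refine (norm_sin_le _).trans (le_of_eq ?_)
    simp [abs_mul, abs_of_nonneg hx₀.1]
  have h3 : ‖ρ‖ * ‖ext (solC hq (ρ ^ 2)) x₀‖ ≤ (1 + l1Norm q * W) *
      Real.exp (|ρ.im| * x₀) := by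
    rw [← norm_mul]
    have := norm_le_norm_sub_add (ρ * ext (solC hq (ρ ^ 2)) x₀) (Complex.sin (ρ * x₀))
    linarith
  have h4 : ‖ρ‖ * W ≤ 1 + l1Norm q * W := by
    have hE : Real.exp (|ρ.im| * x₀) * Real.exp (-(|ρ.im| * x₀)) = 1 := by
      rw [← Real.exp_add]; simp
    calc ‖ρ‖ * W = ‖ρ‖ * ‖ext (solC hq (ρ ^ 2)) x₀‖ * Real.exp (-(|ρ.im| * x₀)) := by
          rw [hWdef]; ring
      _ ≤ (1 + l1Norm q * W) * Real.exp (|ρ.im| * x₀) * Real.exp (-(|ρ.im| * x₀)) :=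
          mul_le_mul_of_nonneg_right h3 (Real.exp_pos _).le
      _ = _ := by rw [mul_assoc, hE, mul_one]
  have h5 : W ≤ 2 / ‖ρ‖ := by
    rw [le_div_iff₀ hρ0]
    nlinarith
  exact (hy x hx).trans (mul_le_mul_of_nonneg_right h5 (Real.exp_pos _).le)

/-- `ρ S(π, ρ²) = sin πρ + O(e^{π|Im ρ|}/ρ)` and `S'(π, ρ²) = cos πρ + O(e^{π|Im ρ|}/ρ)`. -/
theorem sC_asymptotics (hq : IntervalIntegrable q volume 0 Real.pi) {ρ : ℂ}
    (hρ : 2 * l1Norm q + 1 ≤ ‖ρ‖) :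
    ‖ρ * sC hq (ρ ^ 2) - Complex.sin (ρ * Real.pi)‖ ≤
        2 * l1Norm q / ‖ρ‖ * Real.exp (|ρ.im| * Real.pi) ∧
      ‖dsC hq (ρ ^ 2) - Complex.cos (ρ * Real.pi)‖ ≤
        2 * l1Norm q / ‖ρ‖ * Real.exp (|ρ.im| * Real.pi) := by
  have := norm_solC_sub_le hq pi_mem (W := 2 / ‖ρ‖) (by positivity)
    fun t ht => norm_solC_le hq hρ ht
  rw [ext_of_mem _ pi_mem, ext_of_mem _ pi_mem] at this
  have e : l1Norm q * (2 / ‖ρ‖) = 2 * l1Norm q / ‖ρ‖ := by ring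
  rw [e] at this
  exact this

theorem norm_sC_le (hq : IntervalIntegrable q volume 0 Real.pi) {ρ : ℂ}
    (hρ : 2 * l1Norm q + 1 ≤ ‖ρ‖) :
    ‖ρ * sC hq (ρ ^ 2)‖ ≤ 2 * Real.exp (|ρ.im| * Real.pi) ∧
      ‖dsC hq (ρ ^ 2)‖ ≤ 2 * Real.exp (|ρ.im| * Real.pi) := by
  have hQ := l1Norm_nonneg (q := q)
  obtain ⟨h1, h2⟩ := sC_asymptotics hq hρ
  have hE := Real.exp_pos (|ρ.im| * Real.pi)
  have h3 : 2 * l1Norm q / ‖ρ‖ * Real.exp (|ρ.im| * Real.pi) ≤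
      Real.exp (|ρ.im| * Real.pi) := by
    refine mul_le_of_le_one_left hE.le ?_
    rw [div_le_one (by linarith)]
    linarith
  have him : |(ρ * Real.pi).im| = |ρ.im| * Real.pi := by
    simp [abs_mul, abs_of_nonneg Real.pi_pos.le]
  have h4 := norm_sin_le (ρ * Real.pi)
  have h5 := norm_cos_le (ρ * Real.pi)
  rw [him] at h4 h5
  constructor
  · linarith [norm_le_norm_sub_add (ρ * sC hq (ρ ^ 2)) (Complex.sin (ρ * Real.pi))]
  · linarith [norm_le_norm_sub_add (dsC hq (ρ ^ 2)) (Complex.cos (ρ * Real.pi))]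

end Asymptotics

/-! ### Uniqueness for entire functions with too many zeros -/

section ZeroCounting

open Real in
theorem circleAverage_abs_im {R : ℝ} (hR : 0 ≤ R) :
    circleAverage (fun z : ℂ => |z.im|) 0 R = 2 * R / π := by
  have h1 : ∀ θ : ℝ, |(circleMap 0 R θ).im| = R * |sin θ| := by
    intro θ
    rw [circleMap_zero_im, abs_mul, abs_of_nonneg hR]
  have hi : ∀ a b : ℝ, IntervalIntegrable (fun θ => |sin θ|) volume a b := fun a b =>
    (continuous_sin.abs).intervalIntegrable a b
  have i1 : ∫ θ in (0 : ℝ)..π, |sin θ| = 2 := by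
    have h2 : ∫ θ in (0 : ℝ)..π, sin θ = 2 := by rw [integral_sin, cos_zero, cos_pi]; norm_num
    rw [← h2]
    refine intervalIntegral.integral_congr fun θ hθ => ?_
    rw [Set.uIcc_of_le pi_pos.le] at hθ
    exact abs_of_nonneg (sin_nonneg_of_mem_Icc hθ)
  have i2 : ∫ θ in π..(2 * π), |sin θ| = 2 := by
    have : ∫ θ in (0 : ℝ)..π, |sin (θ + π)| = 2 := by
      rw [← i1]
      refine intervalIntegral.integral_congr fun θ _ => ?_
      simp only [sin_add_pi, abs_neg]
    rw [intervalIntegral.integral_comp_add_right (f := fun θ => |sin θ|)] at this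
    rwa [zero_add, ← two_mul] at this
  rw [circleAverage_def]
  simp_rw [h1]
  rw [intervalIntegral.integral_const_mul, ← intervalIntegral.integral_add_adjacent_intervals
    (hi 0 π) (hi π (2 * π)), i1, i2, smul_eq_mul]
  field_simp
  ring

/-- A one-sided form of Stirling's formula. -/
theorem exists_log_factorial_le : ∃ C : ℝ, ∀ n : ℕ, 1 ≤ n →
    Real.log n.factorial ≤ n * Real.log n - n + 1 / 2 * Real.log n + C := by
  refine ⟨1 / 2 * Real.log 2 + Real.log (Stirling.stirlingSeq 1), fun n hn => ?_⟩
  obtain ⟨k, rfl⟩ := Nat.exists_eq_succ_of_ne_zero (Nat.one_le_iff_ne_zero.1 hn)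
  have h1 := Stirling.log_stirlingSeq'_antitone (Nat.zero_le k)
  simp only [Function.comp_apply] at h1
  rw [Stirling.log_stirlingSeq_formula k.succ] at h1
  have hk : ((k.succ : ℕ) : ℝ) ≠ 0 := by positivity
  rw [Real.log_mul two_ne_zero hk, Real.log_div hk (Real.exp_pos 1).ne', Real.log_exp] at h1
  linarith

theorem le_divisor_of_le_order {h : ℂ → ℂ} (hd : Differentiable ℂ h) {z : ℂ} {n : ℕ} {U : Set ℂ}
    (hz : z ∈ U) (htop : analyticOrderAt h z ≠ ⊤) (hn : (n : ℕ∞) ≤ analyticOrderAt h z) :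
    (n : ℤ) ≤ MeromorphicOn.divisor h U z := by
  have ha : AnalyticOnNhd ℂ h U := fun w _ => hd.analyticAt w
  rw [MeromorphicOn.AnalyticOnNhd.divisor_apply ha hz]
  obtain ⟨k, hk⟩ := ENat.ne_top_iff_exists.1 htop
  rw [← hk] at hn ⊢
  have : n ≤ k := by exact_mod_cast hn
  simpa using this

/-- A zero at the origin of an even function is at least double. -/
theorem two_le_order_of_even {h : ℂ → ℂ} (hd : Differentiable ℂ h) (heven : ∀ z, h (-z) = h z)
    (h0 : h 0 = 0) : ((2 : ℕ) : ℕ∞) ≤ analyticOrderAt h 0 := by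
  have hd0 : deriv h 0 = 0 := by
    have h1 : HasDerivAt (fun z => h (-z)) (-deriv h 0) 0 := by
      have := (hd (-0)).hasDerivAt.scomp (0 : ℂ) (hasDerivAt_neg (0 : ℂ))
      simpa [Function.comp_def] using this
    have h2 : HasDerivAt (fun z => h (-z)) (deriv h 0) 0 := by
      simp_rw [heven]; exact (hd 0).hasDerivAt
    have := h1.unique h2
    linear_combination (-1 / 2 : ℂ) * this
  have hd1 : Differentiable ℂ (dslope h 0) := by
    rw [← differentiableOn_univ] at hd ⊢
    exact (Complex.differentiableOn_dslope Filter.univ_mem).2 hd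
  have hd2 : Differentiable ℂ (dslope (dslope h 0) 0) := by
    rw [← differentiableOn_univ] at hd1 ⊢
    exact (Complex.differentiableOn_dslope Filter.univ_mem).2 hd1
  rw [natCast_le_analyticOrderAt (hd.analyticAt 0)]
  refine ⟨dslope (dslope h 0) 0, hd2.analyticAt 0, Filter.Eventually.of_forall fun z => ?_⟩
  have e1 := sub_smul_dslope h 0 z
  have e2 := sub_smul_dslope (dslope h 0) 0 z
  rw [h0, sub_zero] at e1
  rw [dslope_same, hd0, sub_zero] at e2
  rw [pow_two, mul_smul, sub_zero, e2, sub_zero, e1, sub_zero]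

/-- The upper bound for the circle average of `log |h|` given by an exponential growth estimate. -/
theorem circleAverage_log_norm_le {h : ℂ → ℂ} (hd : Differentiable ℂ h) {B a R : ℝ} (hB : 1 ≤ B)
    (ha : 0 ≤ a) (hR : 0 ≤ R)
    (hbound : ∀ z : ℂ, ‖z‖ = R → ‖h z‖ ≤ B * Real.exp (a * |z.im|)) :
    Real.circleAverage (fun z => Real.log ‖h z‖) 0 R ≤ Real.log B + a * (2 * R / Real.pi) := by
  have hmer : MeromorphicOn h (Metric.sphere 0 |R|) := fun z _ => (hd.analyticAt z).meromorphicAt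
  have hcont : Continuous fun z : ℂ => a * |z.im| := by fun_prop
  have e : Real.circleAverage (fun z : ℂ => Real.log B + a * |z.im|) 0 R =
      Real.log B + a * (2 * R / Real.pi) := by
    rw [Real.circleAverage_fun_add (f₁ := fun _ => Real.log B) (circleIntegrable_const _ _ _)
      hcont.continuousOn.circleIntegrable', Real.circleAverage_const,
      ← circleAverage_abs_im hR]
    congr 1
    exact Real.circleAverage_fun_smul (a := a) (f := fun z : ℂ => |z.im|)
  rw [← e]
  refine Real.circleAverage_mono (hmer.circleIntegrable_log_norm)
    ((continuous_const.add hcont).continuousOn.circleIntegrable') fun z hz => ?_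
  have hzR : ‖z‖ = R := by simpa [abs_of_nonneg hR] using hz
  have h1 := hbound z hzR
  have hB0 := Real.log_nonneg hB
  rcases eq_or_ne (h z) 0 with h0 | h0
  · rw [h0, norm_zero, Real.log_zero]
    positivity
  · calc Real.log ‖h z‖ ≤ Real.log (B * Real.exp (a * |z.im|)) :=
          Real.log_le_log (norm_pos_iff.2 h0) h1
      _ = _ := by rw [Real.log_mul (by positivity) (Real.exp_pos _).ne', Real.log_exp]

/-- The lower bound for the circle average of `log |h|` given by Jensen's formula and the zeros
`± r m`, `m < M`, together with a double zero at the origin. -/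
theorem sum_log_le_circleAverage {h : ℂ → ℂ} (hd : Differentiable ℂ h)
    (heven : ∀ z, h (-z) = h z) (hne : ∀ z, analyticOrderAt h z ≠ ⊤) (h0 : h 0 = 0)
    {r : ℕ → ℝ} (hr : ∀ m, 0 < r m) (hinj : Function.Injective r) (hzero : ∀ m, h (r m) = 0)
    {R : ℝ} (hR : 1 ≤ R) {M : ℕ} (hM : ∀ m < M, r m ≤ R) :
    2 * ∑ m ∈ Finset.range M, Real.log (R / r m) + 2 * Real.log R +
      Real.log ‖meromorphicTrailingCoeffAt h 0‖ ≤
        Real.circleAverage (fun z => Real.log ‖h z‖) 0 R := by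
  classical
  have hR0 : 0 < R := by linarith
  have hmer : MeromorphicOn h (Metric.closedBall 0 |R|) :=
    fun z _ => (hd.analyticAt z).meromorphicAt
  rw [MeromorphicOn.circleAverage_log_norm hR0.ne' hmer]
  set D := MeromorphicOn.divisor h (Metric.closedBall 0 |R|) with hD
  have hD0 : (2 : ℝ) ≤ D 0 := by
    have := le_divisor_of_le_order hd (U := Metric.closedBall 0 |R|) (by simp) (hne 0)
      (two_le_order_of_even hd heven h0)
    exact_mod_cast this
  have hDnn : ∀ u, (0 : ℝ) ≤ D u := by
    intro u
    by_cases hu : u ∈ Metric.closedBall (0 : ℂ) |R|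
    · have := le_divisor_of_le_order hd (n := 0) hu (hne u) (by simp)
      exact_mod_cast this
    · rw [Function.locallyFinsuppWithin.apply_eq_zero_of_notMem _ hu]; simp
  have hD1 : ∀ u ∈ Metric.closedBall (0 : ℂ) |R|, h u = 0 → (1 : ℝ) ≤ D u := by
    intro u hu h0
    have := le_divisor_of_le_order hd (n := 1) hu (hne u) (by
      rw [Nat.cast_one, Order.one_le_iff_ne_zero]
      exact ((hd.analyticAt u).analyticOrderAt_ne_zero).2 h0)
    exact_mod_cast this
  have hlog : ∀ u ∈ Metric.closedBall (0 : ℂ) |R|, 0 ≤ Real.log (R * ‖0 - u‖⁻¹) := by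
    intro u hu
    rcases eq_or_ne u 0 with rfl | hu0
    · simp
    · refine Real.log_nonneg ?_
      rw [zero_sub, norm_neg, ← div_eq_mul_inv, one_le_div (norm_pos_iff.2 hu0)]
      simpa [abs_of_pos hR0] using hu
  let Z₁ : Finset ℂ := (Finset.range M).image fun m => (r m : ℂ)
  let Z₂ : Finset ℂ := (Finset.range M).image fun m => (-(r m : ℂ))
  have hdisj : Disjoint Z₁ Z₂ := by
    rw [Finset.disjoint_left]
    intro u h1 h2
    obtain ⟨a, -, rfl⟩ := Finset.mem_image.1 h1
    obtain ⟨b, -, hb⟩ := Finset.mem_image.1 h2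
    have : -(r b) = r a := by exact_mod_cast hb
    linarith [hr a, hr b]
  have hZ : ∀ u ∈ Z₁ ∪ Z₂, u ∈ Metric.closedBall (0 : ℂ) |R| ∧ h u = 0 := by
    intro u hu
    rcases Finset.mem_union.1 hu with hu | hu
    · obtain ⟨a, ha, rfl⟩ := Finset.mem_image.1 hu
      refine ⟨?_, hzero a⟩
      simpa [abs_of_pos hR0, abs_of_pos (hr a)] using hM a (Finset.mem_range.1 ha)
    · obtain ⟨a, ha, rfl⟩ := Finset.mem_image.1 hu
      refine ⟨?_, by rw [heven]; exact hzero a⟩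
      simpa [abs_of_pos hR0, abs_of_pos (hr a)] using hM a (Finset.mem_range.1 ha)
  have hsumZ : ∑ u ∈ Z₁ ∪ Z₂, Real.log (R * ‖0 - u‖⁻¹) =
      2 * ∑ m ∈ Finset.range M, Real.log (R / r m) := by
    rw [Finset.sum_union hdisj, Finset.sum_image, Finset.sum_image, two_mul]
    · congr 1 <;>
      · refine Finset.sum_congr rfl fun m _ => ?_
        simp [abs_of_pos (hr m), div_eq_mul_inv]
    · intro a _ b _ hab
      exact hinj (by simpa using hab)
    · intro a _ b _ hab
      exact hinj (by simpa using hab)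
  have hfin := D.finiteSupport (isCompact_closedBall (0 : ℂ) |R|)
  have hsupp : (Function.support fun u => (D u : ℝ) * Real.log (R * ‖0 - u‖⁻¹)) ⊆
      ((hfin.toFinset ∪ (Z₁ ∪ Z₂) : Finset ℂ) : Set ℂ) := by
    intro u hu
    rw [Finset.mem_coe, Finset.mem_union]
    left
    rw [Set.Finite.mem_toFinset]
    intro h
    apply hu
    simp only
    rw [h]; simp
  rw [finsum_eq_sum_of_support_subset _ hsupp]
  have hmain : 2 * ∑ m ∈ Finset.range M, Real.log (R / r m) ≤
      ∑ u ∈ hfin.toFinset ∪ (Z₁ ∪ Z₂), (D u : ℝ) * Real.log (R * ‖0 - u‖⁻¹) := by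
    rw [← hsumZ]
    refine le_trans (Finset.sum_le_sum fun u hu => ?_) (Finset.sum_le_sum_of_subset_of_nonneg
      Finset.subset_union_right fun u _ _ => ?_)
    · exact le_mul_of_one_le_left (hlog u (hZ u hu).1) (hD1 u (hZ u hu).1 (hZ u hu).2)
    · by_cases hu : u ∈ Metric.closedBall (0 : ℂ) |R|
      · exact mul_nonneg (hDnn u) (hlog u hu)
      · rw [Function.locallyFinsuppWithin.apply_eq_zero_of_notMem _ hu]; simp
  have := mul_le_mul_of_nonneg_right hD0 (Real.log_nonneg hR)
  linarith

/-- The lower bound for the zero-counting sum when the `m`-th zero is at most `m/2 + O(1/m)`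
(`m = 1, 2, …`), evaluated on the circle of radius `M/2 + 1`. -/
theorem exists_le_sum_log {r : ℕ → ℝ} (hr : ∀ m, 0 < r m) {C : ℝ}
    (hC : ∀ m : ℕ, r m ≤ (m + 1) / 2 + C / (m + 1)) :
    ∃ K : ℝ, ∀ M : ℕ, 1 ≤ M → 2 * M - Real.log M - K ≤
      2 * ∑ m ∈ Finset.range M, Real.log ((M / 2 + 1) / r m) := by
  obtain ⟨S, hS⟩ := exists_log_factorial_le
  have hsum : Summable fun m : ℕ => 2 * |C| / ((m : ℝ) + 1) ^ 2 := by
    have := (summable_nat_add_iff 1).2 (Real.summable_one_div_nat_pow.2 one_lt_two)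
    refine (this.mul_left (2 * |C|)).congr fun m => ?_
    push_cast
    ring
  set T := ∑' m : ℕ, 2 * |C| / ((m : ℝ) + 1) ^ 2 with hT
  refine ⟨2 * (S + T), fun M hM => ?_⟩
  have hM0 : (0 : ℝ) < M := by exact_mod_cast hM
  have hterm : ∀ m : ℕ, Real.log M - Real.log (m + 1) - 2 * |C| / ((m : ℝ) + 1) ^ 2 ≤
      Real.log ((M / 2 + 1) / r m) := by
    intro m
    have hm : (0 : ℝ) < m + 1 := by positivity
    have h1 : Real.log ((M : ℝ) / (m + 1)) - Real.log (2 * r m / (m + 1)) =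
        Real.log ((M / 2) / r m) := by
      have := hr m
      rw [← Real.log_div (by positivity) (by positivity)]
      congr 1
      field_simp
    have h2 : Real.log (2 * r m / (m + 1)) ≤ 2 * |C| / ((m : ℝ) + 1) ^ 2 := by
      have := hr m
      refine (Real.log_le_sub_one_of_pos (by positivity)).trans ?_
      have h3 : r m ≤ (m + 1) / 2 + |C| / (m + 1) :=
        (hC m).trans (by have := le_abs_self C; gcongr)
      calc 2 * r m / (m + 1) - 1 ≤ 2 * ((m + 1) / 2 + |C| / (m + 1)) / (m + 1) - 1 := by gcongr
        _ = _ := by field_simp; ring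
    have h4 : Real.log ((M / 2) / r m) ≤ Real.log ((M / 2 + 1) / r m) := by
      have := hr m
      refine Real.log_le_log (by positivity) ?_
      gcongr
      linarith
    rw [Real.log_div hM0.ne' hm.ne'] at h1
    linarith
  have hfac : ∑ m ∈ Finset.range M, Real.log ((m : ℝ) + 1) = Real.log M.factorial := by
    rw [← Finset.prod_range_add_one_eq_factorial, Nat.cast_prod,
      Real.log_prod (fun i _ => by positivity)]
    simp
  have hpart : ∑ m ∈ Finset.range M, 2 * |C| / ((m : ℝ) + 1) ^ 2 ≤ T :=
    hsum.sum_le_tsum _ fun m _ => by positivity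
  have h5 := Finset.sum_le_sum fun m (_ : m ∈ Finset.range M) => hterm m
  rw [Finset.sum_sub_distrib, Finset.sum_sub_distrib, hfac, Finset.sum_const, Finset.card_range,
    nsmul_eq_mul] at h5
  linarith [hS M hM]

/-- An even entire function of exponential type `2π`, bounded on the real axis, cannot vanish at the
origin and at points `± r m` with `r m ≤ m/2 + O(1/m)`, `m = 1, 2, …`, unless it is zero: it would
have as many zeros as `z sin 2πz`, and Jensen's formula would force a growth by an additional factor
`|z|`. -/
theorem eq_zero_of_zeros {h : ℂ → ℂ} (hd : Differentiable ℂ h) (heven : ∀ z, h (-z) = h z)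
    {B R₀ : ℝ} (hbound : ∀ z : ℂ, R₀ ≤ ‖z‖ → ‖h z‖ ≤ B * Real.exp (2 * Real.pi * |z.im|))
    (h0 : h 0 = 0) {r : ℕ → ℝ} (hr : ∀ m, 0 < r m) (hinj : Function.Injective r)
    (hzero : ∀ m, h (r m) = 0) {C : ℝ} (hC : ∀ m : ℕ, r m ≤ (m + 1) / 2 + C / (m + 1)) :
    ∀ z, h z = 0 := by
  by_contra! hcon
  obtain ⟨z₀, hz₀⟩ := hcon
  have hne : ∀ z, analyticOrderAt h z ≠ ⊤ := by
    intro z hz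
    apply hz₀
    have h1 : AnalyticOnNhd ℂ h Set.univ := fun w _ => hd.analyticAt w
    have h2 : AnalyticOnNhd ℂ (fun _ : ℂ => (0 : ℂ)) Set.univ := fun w _ => analyticAt_const
    exact congrFun (h1.eq_of_eventuallyEq h2 (analyticOrderAt_eq_top.1 hz)) z₀
  obtain ⟨K, hK⟩ := exists_le_sum_log hr hC
  set c := Real.log ‖meromorphicTrailingCoeffAt h 0‖ with hc
  set B' := max B 1 with hB'
  -- the inequality between the two sides of Jensen's formula bounds `log M`
  have key : ∀ M : ℕ, 1 ≤ M → 2 * R₀ ≤ M → 3 * |C| ≤ M →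
      Real.log M ≤ Real.log B' + 4 + K - c + 2 * Real.log 2 := by
    intro M hM1 hMR hMC
    have hM0 : (1 : ℝ) ≤ M := by exact_mod_cast hM1
    set R : ℝ := M / 2 + 1 with hR
    have hup := circleAverage_log_norm_le hd (B := B') (a := 2 * Real.pi) (R := R)
      (le_max_right _ _) (by positivity) (by positivity) fun z hz =>
        (hbound z (by linarith)).trans
          (mul_le_mul_of_nonneg_right (le_max_left _ _) (Real.exp_pos _).le)
    have hlow := sum_log_le_circleAverage hd heven hne h0 hr hinj hzero (R := R) (by linarith)
      (M := M) (fun m hm => by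
        have hm' : (m : ℝ) + 1 ≤ M := by exact_mod_cast hm
        have hmp : (0 : ℝ) < m + 1 := by positivity
        refine (hC m).trans ?_
        have h1 : C / ((m : ℝ) + 1) ≤ |C| / (m + 1) := by have := le_abs_self C; gcongr
        rcases le_total (|C|) ((m : ℝ) + 1) with h2 | h2
        · have : |C| / ((m : ℝ) + 1) ≤ 1 := (div_le_one hmp).2 h2
          linarith
        · have : |C| / ((m : ℝ) + 1) ≤ |C| := div_le_self (abs_nonneg _)
            (by linarith [Nat.cast_nonneg (α := ℝ) m])
          linarith)
    have h3 := hK M hM1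
    have h4 : 2 * Real.pi * (2 * R / Real.pi) = 2 * M + 4 := by
      rw [hR]; field_simp; ring
    have h5 : Real.log M - Real.log 2 ≤ Real.log R := by
      rw [← Real.log_div (by positivity) two_ne_zero]
      exact Real.log_le_log (by positivity) (by linarith)
    rw [h4] at hup
    linarith
  have hlim : Filter.Tendsto (fun M : ℕ => Real.log M) Filter.atTop Filter.atTop :=
    Real.tendsto_log_atTop.comp tendsto_natCast_atTop_atTop
  have hnat := tendsto_natCast_atTop_atTop (R := ℝ)
  obtain ⟨M, h1, h2, h3, h4⟩ := ((hlim.eventually_gt_atTop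
    (Real.log B' + 4 + K - c + 2 * Real.log 2)).and ((Filter.eventually_ge_atTop 1).and
      ((hnat.eventually_ge_atTop (2 * R₀)).and (hnat.eventually_ge_atTop (3 * |C|))))).exists
  exact absurd (key M h2 h3 h4) (not_le.2 h1)

end ZeroCounting

/-! ### Fourier transforms and Liouville's theorem -/

section Liouville

/-- Differentiation under the integral sign: transforms with an entire kernel are entire. -/
theorem differentiable_transform {f : ℝ → ℝ} (hf : IntervalIntegrable f volume 0 Real.pi)
    {g g' : ℂ → ℂ} (hg : ∀ z, HasDerivAt g (g' z) z) (hg' : Continuous g') :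
    Differentiable ℂ fun ρ : ℂ => ∫ t in (0 : ℝ)..Real.pi, (f t : ℂ) * g (ρ * t) := by
  intro ρ₀
  have hgc : Continuous g := continuous_iff_continuousAt.2 fun z => (hg z).continuousAt
  have hfC : IntervalIntegrable (fun t => (f t : ℂ)) volume 0 Real.pi :=
    ⟨hf.1.ofReal, hf.2.ofReal⟩
  obtain ⟨C, hC⟩ := ((isCompact_closedBall ρ₀ 1).prod
    (isCompact_Icc (a := (0 : ℝ)) (b := Real.pi))).exists_bound_of_continuousOn
      (f := fun p : ℂ × ℝ => g' (p.1 * p.2) * p.2) (by fun_prop)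
  have hint : ∀ ρ : ℂ, IntervalIntegrable (fun t : ℝ => (f t : ℂ) * g (ρ * t)) volume 0 Real.pi :=
    fun ρ => hfC.mul_continuousOn (by fun_prop)
  have hint' : IntervalIntegrable (fun t : ℝ => (f t : ℂ) * (g' (ρ₀ * t) * t)) volume 0 Real.pi :=
    hfC.mul_continuousOn (by fun_prop)
  refine (intervalIntegral.hasDerivAt_integral_of_dominated_loc_of_deriv_le
    (F' := fun ρ t => (f t : ℂ) * (g' (ρ * t) * t)) (bound := fun t => ‖f t‖ * C)
    (Metric.closedBall_mem_nhds ρ₀ one_pos)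
    (Filter.Eventually.of_forall fun ρ => (hint ρ).def'.aestronglyMeasurable) (hint ρ₀)
    hint'.def'.aestronglyMeasurable ?_ (hf.norm.mul_const C) ?_).2.differentiableAt
  · refine Filter.Eventually.of_forall fun t ht ρ hρ => ?_
    rw [norm_mul, Complex.norm_real]
    refine mul_le_mul_of_nonneg_left (hC (ρ, t) ⟨hρ, ?_⟩) (norm_nonneg _)
    rw [Set.uIoc_of_le Real.pi_pos.le] at ht
    exact ⟨ht.1.le, ht.2⟩
  · refine Filter.Eventually.of_forall fun t _ ρ _ => ?_
    have h1 : HasDerivAt (fun ρ : ℂ => ρ * (t : ℂ)) (t : ℂ) ρ := by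
      simpa using (hasDerivAt_id ρ).mul_const (t : ℂ)
    exact ((hg (ρ * t)).comp ρ h1).const_mul _

/-- `∫₀^π f(t) cos ρt dt`, as a function of a complex `ρ`. -/
noncomputable def cosT (f : ℝ → ℝ) (ρ : ℂ) : ℂ :=
  ∫ t in (0 : ℝ)..Real.pi, (f t : ℂ) * Complex.cos (ρ * t)

/-- `∫₀^π f(t) sin ρt dt`, as a function of a complex `ρ`. -/
noncomputable def sinT (f : ℝ → ℝ) (ρ : ℂ) : ℂ :=
  ∫ t in (0 : ℝ)..Real.pi, (f t : ℂ) * Complex.sin (ρ * t)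

theorem differentiable_cosT {f : ℝ → ℝ} (hf : IntervalIntegrable f volume 0 Real.pi) :
    Differentiable ℂ (cosT f) :=
  differentiable_transform hf Complex.hasDerivAt_cos (by fun_prop)

theorem differentiable_sinT {f : ℝ → ℝ} (hf : IntervalIntegrable f volume 0 Real.pi) :
    Differentiable ℂ (sinT f) :=
  differentiable_transform hf Complex.hasDerivAt_sin (by fun_prop)

theorem cosT_neg (f : ℝ → ℝ) (ρ : ℂ) : cosT f (-ρ) = cosT f ρ := by
  simp [cosT]

theorem sinT_neg (f : ℝ → ℝ) (ρ : ℂ) : sinT f (-ρ) = -sinT f ρ := by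
  simp [sinT]

theorem norm_transform_le {f : ℝ → ℝ} (hf : IntervalIntegrable f volume 0 Real.pi)
    {g : ℂ → ℂ} (hg : ∀ z : ℂ, ‖g z‖ ≤ Real.exp |z.im|) (ρ : ℂ) :
    ‖∫ t in (0 : ℝ)..Real.pi, (f t : ℂ) * g (ρ * t)‖ ≤
      l1Norm f * Real.exp (|ρ.im| * Real.pi) := by
  rw [l1Norm, ← intervalIntegral.integral_mul_const]
  refine intervalIntegral.norm_integral_le_of_norm_le Real.pi_pos.le
    (Filter.Eventually.of_forall fun t ht => ?_) (hf.norm.mul_const _)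
  rw [norm_mul, Complex.norm_real]
  refine mul_le_mul_of_nonneg_left ((hg _).trans (Real.exp_le_exp.2 ?_)) (norm_nonneg _)
  have : (ρ * t).im = ρ.im * t := by simp
  rw [this, abs_mul, abs_of_pos ht.1]
  exact mul_le_mul_of_nonneg_left ht.2 (abs_nonneg _)

theorem norm_cosT_le {f : ℝ → ℝ} (hf : IntervalIntegrable f volume 0 Real.pi) (ρ : ℂ) :
    ‖cosT f ρ‖ ≤ l1Norm f * Real.exp (|ρ.im| * Real.pi) :=
  norm_transform_le hf norm_cos_le ρ

theorem norm_sinT_le {f : ℝ → ℝ} (hf : IntervalIntegrable f volume 0 Real.pi) (ρ : ℂ) :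
    ‖sinT f ρ‖ ≤ l1Norm f * Real.exp (|ρ.im| * Real.pi) :=
  norm_transform_le hf norm_sin_le ρ

theorem norm_sin_sq (x y : ℝ) :
    ‖Complex.sin (x + y * Complex.I)‖ ^ 2 = Real.sin x ^ 2 + Real.sinh y ^ 2 := by
  rw [Complex.sin_add_mul_I, ← Complex.ofReal_sin, ← Complex.ofReal_cos, ← Complex.ofReal_cosh,
    ← Complex.ofReal_sinh, ← Complex.normSq_eq_norm_sq, ← Complex.ofReal_mul, ← Complex.ofReal_mul,
    Complex.normSq_add_mul_I]
  have h1 := Real.sin_sq_add_cos_sq x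
  have h2 := Real.cosh_sq y
  nlinarith

/-- On the circles `|ρ| = N + 1/2` the function `sin πρ` attains its maximal order of growth. -/
theorem exp_le_norm_sin {ρ : ℂ} {N : ℕ} (hρ : ‖ρ‖ = N + 1 / 2) :
    Real.exp (|ρ.im| * Real.pi) / 8 ≤ ‖Complex.sin (ρ * Real.pi)‖ := by
  have hπ := Real.pi_pos
  have hπ3 := Real.pi_gt_three
  refine le_of_sq_le_sq ?_ (norm_nonneg _)
  have e : ρ * Real.pi = ((ρ.re * Real.pi : ℝ) : ℂ) + ((ρ.im * Real.pi : ℝ) : ℂ) * Complex.I := by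
    conv_lhs => rw [← Complex.re_add_im ρ]
    push_cast
    ring
  rw [e, norm_sin_sq]
  set Y := |ρ.im| * Real.pi with hY
  have hY0 : 0 ≤ Y := by positivity
  have hsinh : Real.sinh (ρ.im * Real.pi) ^ 2 = Real.sinh Y ^ 2 := by
    rw [← sq_abs, Real.abs_sinh, abs_mul, abs_of_pos hπ]
  rw [hsinh]
  have hexp : 0 < Real.exp Y := Real.exp_pos _
  rcases le_total 1 Y with h1 | h1
  · -- far from the real axis `sinh` dominates
    have h2 : Real.exp (-Y) ≤ Real.exp Y / 2 := by
      have h3 : Real.exp (-Y) * Real.exp Y = 1 := by rw [← Real.exp_add]; simp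
      have h4 : 2 ≤ Real.exp Y := by linarith [Real.add_one_le_exp Y]
      nlinarith [Real.exp_pos (-Y)]
    have h3 : Real.exp Y / 8 ≤ Real.sinh Y := by
      rw [Real.sinh_eq]; linarith
    have h4 := pow_le_pow_left₀ (by positivity) h3 2
    nlinarith [sq_nonneg (Real.sin (ρ.re * Real.pi))]
  · -- near the real axis `|Re ρ|` lies in `[N + 1/4, N + 1/2]`
    have him : |ρ.im| ≤ 1 / 3 := by
      rw [hY] at h1
      nlinarith [abs_nonneg ρ.im]
    have hN : (0 : ℝ) ≤ N := Nat.cast_nonneg N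
    have hsq : |ρ.re| ^ 2 + |ρ.im| ^ 2 = (N + 1 / 2) ^ 2 := by
      rw [← hρ, ← Complex.normSq_eq_norm_sq, Complex.normSq_apply, sq_abs, sq_abs]
      ring
    have hre0 := abs_nonneg ρ.re
    have hlow : (N : ℝ) + 1 / 4 ≤ |ρ.re| := by
      by_contra! hcon
      nlinarith [abs_nonneg ρ.im]
    have hup : |ρ.re| ≤ (N : ℝ) + 1 / 2 := by
      by_contra! hcon
      nlinarith [sq_nonneg |ρ.im|]
    have hcos : Real.cos (2 * (ρ.re * Real.pi)) ≤ 0 := by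
      have e1 : Real.cos (2 * (ρ.re * Real.pi)) =
          Real.cos (2 * Real.pi * (|ρ.re| - N)) := by
        have : 2 * (|ρ.re| * Real.pi) = 2 * Real.pi * (|ρ.re| - N) + N * (2 * Real.pi) := by ring
        rw [← Real.cos_abs, abs_mul, abs_mul, abs_two, abs_of_pos hπ, this,
          Real.cos_add_nat_mul_two_pi]
      rw [e1]
      refine Real.cos_nonpos_of_pi_div_two_le_of_le ?_ ?_ <;> nlinarith
    have hsin : 1 / 2 ≤ Real.sin (ρ.re * Real.pi) ^ 2 := by
      rw [Real.sin_sq_eq_half_sub]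
      linarith
    have h2 : Real.exp Y ≤ 3 := by
      have := Real.exp_le_exp.2 h1
      linarith [Real.exp_one_lt_d9]
    nlinarith [sq_nonneg (Real.sinh Y)]

/-- A form of Liouville's theorem: an even entire function that vanishes at the origin and is
`O(|z|)` on the circles `|z| = N + 1/2` is zero. -/
theorem eq_zero_of_bound_on_circles {G : ℂ → ℂ} (hG : Differentiable ℂ G)
    (heven : ∀ z, G (-z) = G z) (h0 : G 0 = 0) {K : ℝ} {N₀ : ℕ}
    (hK : ∀ N : ℕ, N₀ ≤ N → ∀ z : ℂ, ‖z‖ = N + 1 / 2 → ‖G z‖ ≤ K * ‖z‖) : ∀ z, G z = 0 := by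
  -- `G z / z` is entire and bounded, hence constant; evenness makes the constant vanish
  have hH : Differentiable ℂ (dslope G 0) := by
    rw [← differentiableOn_univ] at hG ⊢
    exact (Complex.differentiableOn_dslope Filter.univ_mem).2 hG
  have hmul : ∀ z, z * dslope G 0 z = G z := by
    intro z
    have := sub_smul_dslope G 0 z
    simpa [h0] using this
  have hbd : ∀ z, ‖dslope G 0 z‖ ≤ K := by
    intro z
    obtain ⟨N, hN⟩ := exists_nat_ge (max ‖z‖ N₀)
    have hN0 : N₀ ≤ N := by exact_mod_cast (le_max_right _ _).trans hN
    have hpos : (0 : ℝ) < N + 1 / 2 := by positivity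
    refine Complex.norm_le_of_forall_mem_frontier_norm_le (U := Metric.ball 0 ((N : ℝ) + 1 / 2))
      Metric.isBounded_ball hH.diffContOnCl (fun w hw => ?_) (subset_closure ?_)
    · rw [frontier_ball _ hpos.ne', mem_sphere_zero_iff_norm] at hw
      have h1 := hK N hN0 w hw
      rw [← hmul w, norm_mul, mul_comm] at h1
      exact le_of_mul_le_mul_right h1 (by rw [hw]; exact hpos)
    · rw [mem_ball_zero_iff]
      linarith [(le_max_left ‖z‖ (N₀ : ℝ)).trans hN]
  have hconst : ∀ z, dslope G 0 z = dslope G 0 0 := fun z =>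
    hH.apply_eq_apply_of_bounded (isBounded_iff_forall_norm_le.2
      ⟨K, by rintro _ ⟨w, rfl⟩; exact hbd w⟩) z 0
  intro z
  have h1 := heven z
  rw [← hmul z, ← hmul (-z), hconst z, hconst (-z)] at h1
  rw [← hmul z, hconst z]
  linear_combination (-1 / 2 : ℂ) * h1

variable {q : ℝ → ℝ}

/-- If `S F₁ = S' F₂` identically, with `F₁ = ρ ∫ f₁ sin ρt` and `F₂ = ∫ f₂ cos ρt`, then both sides
vanish: since `S` and `S'` have no common zeros, the quotient `F₂ / S = F₁ / S'` is entire, and it is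
`O(ρ)` on the circles `|ρ| = N + 1/2`. -/
theorem transforms_eq_zero (hq : IntervalIntegrable q volume 0 Real.pi) (hd0 : dsC hq 0 ≠ 0)
    {f₁ f₂ : ℝ → ℝ} (hf₁ : IntervalIntegrable f₁ volume 0 Real.pi)
    (hf₂ : IntervalIntegrable f₂ volume 0 Real.pi)
    (h : ∀ ρ : ℂ, sC hq (ρ ^ 2) * (ρ * sinT f₁ ρ) = dsC hq (ρ ^ 2) * cosT f₂ ρ) :
    ∀ ρ : ℂ, ρ * sinT f₁ ρ = 0 ∧ cosT f₂ ρ = 0 := by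
  classical
  have dS : Differentiable ℂ fun ρ : ℂ => sC hq (ρ ^ 2) := (differentiable_sC hq).comp (by fun_prop)
  have dS' : Differentiable ℂ fun ρ : ℂ => dsC hq (ρ ^ 2) :=
    (differentiable_dsC hq).comp (by fun_prop)
  have dF₁ : Differentiable ℂ fun ρ : ℂ => ρ * sinT f₁ ρ :=
    differentiable_id.mul (differentiable_sinT hf₁)
  have dF₂ := differentiable_cosT hf₂
  let G : ℂ → ℂ := fun ρ =>
    if sC hq (ρ ^ 2) ≠ 0 then cosT f₂ ρ / sC hq (ρ ^ 2) else ρ * sinT f₁ ρ / dsC hq (ρ ^ 2)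
  have hG : ∀ ρ, sC hq (ρ ^ 2) * G ρ = cosT f₂ ρ ∧ dsC hq (ρ ^ 2) * G ρ = ρ * sinT f₁ ρ := by
    intro ρ
    have hρ := h ρ
    by_cases hs : sC hq (ρ ^ 2) = 0
    · have hs' := (sC_or_dsC_ne_zero hq (ρ ^ 2)).resolve_left (not_not.2 hs)
      have hz : cosT f₂ ρ = 0 := by
        rw [hs, zero_mul] at hρ
        exact (mul_eq_zero.1 hρ.symm).resolve_left hs'
      simp only [G, hs, hz, ne_eq, not_true_eq_false, if_false, zero_mul, true_and]
      field_simp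
    · simp only [G, hs, ne_eq, not_false_eq_true, if_true]
      constructor
      · field_simp
      · field_simp
        linear_combination -hρ
  have hGd : Differentiable ℂ G := by
    intro ρ
    rcases sC_or_dsC_ne_zero hq (ρ ^ 2) with hs | hs
    · refine ((dF₂ ρ).div (dS ρ) hs).congr_of_eventuallyEq ?_
      filter_upwards [(dS ρ).continuousAt.eventually_ne hs] with w hw
      rw [Pi.div_apply, eq_div_iff hw, mul_comm]
      exact (hG w).1
    · refine ((dF₁ ρ).div (dS' ρ) hs).congr_of_eventuallyEq ?_
      filter_upwards [(dS' ρ).continuousAt.eventually_ne hs] with w hw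
      rw [Pi.div_apply, eq_div_iff hw, mul_comm]
      exact (hG w).2
  have heven : ∀ ρ, G (-ρ) = G ρ := by
    intro ρ
    simp only [G, neg_sq, cosT_neg, sinT_neg, neg_mul_neg]
  have hG0 : G 0 = 0 := by
    have := (hG 0).2
    rw [zero_mul, zero_pow two_ne_zero] at this
    exact (mul_eq_zero.1 this).resolve_left hd0
  have hQ := l1Norm_nonneg (q := q)
  obtain ⟨N₀, hN₀⟩ := exists_nat_ge (32 * l1Norm q + 1)
  have hzero := eq_zero_of_bound_on_circles hGd heven hG0 (K := 16 * l1Norm f₂) (N₀ := N₀)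
    (fun N hN ρ hρ => by
      have hN' : (N₀ : ℝ) ≤ N := by exact_mod_cast hN
      have hρ1 : 32 * l1Norm q + 1 ≤ ‖ρ‖ := by linarith
      have hρ0 : 0 < ‖ρ‖ := by linarith
      have h1 := (sC_asymptotics hq (ρ := ρ) (by linarith)).1
      have h2 := exp_le_norm_sin hρ
      have h3 := norm_cosT_le hf₂ ρ
      set E := Real.exp (|ρ.im| * Real.pi) with hE
      have hE0 : 0 < E := Real.exp_pos _
      have h4 : 2 * l1Norm q / ‖ρ‖ * E ≤ E / 16 := by
        have : 2 * l1Norm q / ‖ρ‖ ≤ 1 / 16 := by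
          rw [div_le_iff₀ hρ0]; linarith
        calc _ ≤ 1 / 16 * E := mul_le_mul_of_nonneg_right this hE0.le
          _ = _ := by ring
      have h5 : E / 16 ≤ ‖ρ * sC hq (ρ ^ 2)‖ := by
        have := norm_le_norm_sub_add (Complex.sin (ρ * Real.pi)) (ρ * sC hq (ρ ^ 2))
        rw [norm_sub_rev] at this
        linarith
      have h6 : ‖ρ * sC hq (ρ ^ 2)‖ * ‖G ρ‖ = ‖ρ‖ * ‖cosT f₂ ρ‖ := by
        rw [← norm_mul, ← norm_mul, ← (hG ρ).1, mul_assoc]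
      have h7 : E / 16 * ‖G ρ‖ ≤ E / 16 * (16 * l1Norm f₂ * ‖ρ‖) :=
        calc E / 16 * ‖G ρ‖ ≤ ‖ρ * sC hq (ρ ^ 2)‖ * ‖G ρ‖ :=
              mul_le_mul_of_nonneg_right h5 (norm_nonneg _)
          _ = ‖ρ‖ * ‖cosT f₂ ρ‖ := h6
          _ ≤ ‖ρ‖ * (l1Norm f₂ * E) := mul_le_mul_of_nonneg_left h3 hρ0.le
          _ = _ := by ring
      exact le_of_mul_le_mul_left h7 (by positivity))
  intro ρ
  have := hG ρ
  rw [hzero ρ, mul_zero, mul_zero] at this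
  exact ⟨this.2.symm, this.1.symm⟩

end Liouville

/-! ### Quadratic closeness -/

section Closeness

theorem norm_vec_sq_le {f₁ f₂ : C(ℝ, ℝ)} {a b : ℝ}
    (h₁ : ∀ t ∈ Set.Icc 0 Real.pi, |f₁ t| ≤ a) (h₂ : ∀ t ∈ Set.Icc 0 Real.pi, |f₂ t| ≤ b) :
    ‖vec f₁ f₂‖ ^ 2 ≤ Real.pi * (a ^ 2 + b ^ 2) := by
  have key : ∀ (f : C(ℝ, ℝ)) (a : ℝ), (∀ t ∈ Set.Icc 0 Real.pi, |f t| ≤ a) →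
      ∫ t in (0 : ℝ)..Real.pi, f t * f t ≤ Real.pi * a ^ 2 := by
    intro f a h
    have h1 : ∫ t in (0 : ℝ)..Real.pi, f t * f t ≤ ∫ _ in (0 : ℝ)..Real.pi, a ^ 2 := by
      refine intervalIntegral.integral_mono_on Real.pi_pos.le
        (Continuous.intervalIntegrable (by fun_prop) _ _) (by simp) fun t ht => ?_
      rw [← pow_two, ← sq_abs]
      exact pow_le_pow_left₀ (abs_nonneg _) (h t ht) 2
    simpa using h1
  rw [← real_inner_self_eq_norm_sq, inner_vec_vec, mul_add]
  exact add_le_add (key _ _ h₁) (key _ _ h₂)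

theorem vec_sub_smul_vec (f₁ f₂ g₁ g₂ : C(ℝ, ℝ)) (c : ℝ) :
    vec f₁ f₂ - c • vec g₁ g₂ = vec (f₁ - c • g₁) (f₂ - c • g₂) := rfl

/-- Only the boundedness of the remainders `ϰ n` enters: `ρ n = a n + O(1/n)`. -/
theorem HasAsymptotics.exists_abs_sub_le {ρ a : ℕ → ℝ} {c : ℝ} (h : HasAsymptotics ρ a c) :
    ∃ C, 0 ≤ C ∧ ∀ n : ℕ, |ρ (n + 1) - a (n + 1)| ≤ C / (n + 1) := by
  obtain ⟨ϰ, hs, h⟩ := h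
  have hπ := Real.pi_pos
  set K := ∑' n, ϰ n ^ 2
  have hK : ∀ n, |ϰ n| ≤ 1 + K := fun n => by
    have h1 : ϰ n ^ 2 ≤ K := hs.le_tsum n fun _ _ => sq_nonneg _
    nlinarith [sq_abs (ϰ n), sq_nonneg (|ϰ n| - 1)]
  refine ⟨|c| / Real.pi + (1 + K), ?_, fun n => ?_⟩
  · have := (abs_nonneg _).trans (hK 0)
    positivity
  · have hn : (0 : ℝ) < (n : ℝ) + 1 := by positivity
    have e : ρ (n + 1) - a (n + 1) = (c / Real.pi + ϰ (n + 1)) / (n + 1) := by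
      rw [h (n + 1) (by omega)]
      push_cast
      field_simp
      ring
    rw [e, abs_div, abs_of_pos hn]
    gcongr
    refine (abs_add_le _ _).trans (add_le_add ?_ (hK _))
    rw [abs_div, abs_of_pos hπ]

theorem summable_of_eventually_le_div_sq {F : ℕ → ℝ} (hF : ∀ n, 0 ≤ F n) {K : ℝ}
    (h : ∀ᶠ n : ℕ in Filter.atTop, F n ≤ K * (1 / ((n : ℝ) + 1)) ^ 2) : Summable F := by
  have h1 : Summable fun n : ℕ => K * (1 / ((n : ℝ) + 1)) ^ 2 := by
    refine Summable.mul_left K ?_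
    have := (summable_nat_add_iff 1).2 (Real.summable_nat_pow_inv.2 one_lt_two)
    refine this.congr fun n => ?_
    push_cast
    rw [one_div, inv_pow]
  refine Summable.of_norm_bounded_eventually_nat h1 (h.mono fun n hn => ?_)
  rwa [Real.norm_of_nonneg (hF n)]

/-- If `s² + c² = 1` with `c` small, then `|s|` is close to `1`, so a quotient `X / Y` with `X` near
`c` and `Y` near `s` is small. -/
theorem abs_div_le_of_close {X Y s c δ : ℝ} (hsc : s ^ 2 + c ^ 2 = 1) (hX : |X - c| ≤ δ)
    (hY : |Y - s| ≤ δ) (hc : |c| ≤ δ) (hδ : δ ≤ 1 / 4) : |X / Y| ≤ 4 * δ := by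
  have hδ0 := (abs_nonneg _).trans hc
  have hs : 3 / 4 ≤ |s| := by
    by_contra! hcon
    nlinarith [sq_abs s, sq_abs c, abs_nonneg s, abs_nonneg c]
  have hY' : 1 / 2 ≤ |Y| := by
    have := abs_sub_abs_le_abs_sub s Y
    rw [abs_sub_comm] at this
    linarith
  have hX' : |X| ≤ 2 * δ := by
    have := abs_sub_abs_le_abs_sub X c
    linarith
  rw [abs_div, div_le_iff₀ (by linarith)]
  nlinarith

variable {q : ℝ → ℝ}

theorem SPi_asymptotics (hq : IntervalIntegrable q volume 0 Real.pi) {r : ℝ} (hr0 : 0 < r)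
    (hr : 2 * l1Norm q + 1 ≤ r) :
    |r * SPi q (r ^ 2) - Real.sin (r * Real.pi)| ≤ 2 * l1Norm q / r ∧
      |dSPi q (r ^ 2) - Real.cos (r * Real.pi)| ≤ 2 * l1Norm q / r := by
  have hn : ‖(r : ℂ)‖ = r := by rw [Complex.norm_real, Real.norm_of_nonneg hr0.le]
  have h := sC_asymptotics hq (ρ := (r : ℂ)) (by rwa [hn])
  have e := sC_ofReal hq (r ^ 2)
  rw [hn] at h
  rw [← Complex.ofReal_pow, e.1, e.2] at h
  simp only [Complex.ofReal_im, abs_zero, zero_mul, Real.exp_zero, mul_one] at h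
  constructor
  · refine le_trans (le_of_eq ?_) h.1
    rw [← Real.norm_eq_abs, ← Complex.norm_real]
    push_cast
    rfl
  · refine le_trans (le_of_eq ?_) h.2
    rw [← Real.norm_eq_abs, ← Complex.norm_real]
    push_cast
    rfl

/-- Along a sequence `r n = a n + O(1/n)` growing linearly, the quantities `r S(π, r²)`, `sin rπ`,
`sin aπ`, and likewise `S'(π, r²)`, `cos rπ`, `cos aπ`, agree up to `O(1/n)`. -/
theorem eventually_close (hq : IntervalIntegrable q volume 0 Real.pi) {r a : ℕ → ℝ} {C : ℝ}
    (hC : 0 ≤ C) (hr : ∀ n : ℕ, |r n - a n| ≤ C / (n + 1))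
    (ha : ∀ n : ℕ, ((n : ℝ) + 1) / 2 ≤ a n) :
    ∃ D : ℝ, ∀ᶠ n : ℕ in Filter.atTop,
      |r n * SPi q (r n ^ 2) - Real.sin (a n * Real.pi)| ≤ D * (1 / ((n : ℝ) + 1)) ∧
      |dSPi q (r n ^ 2) - Real.cos (a n * Real.pi)| ≤ D * (1 / ((n : ℝ) + 1)) ∧
      |r n - a n| * Real.pi ≤ D * (1 / ((n : ℝ) + 1)) ∧ D * (1 / ((n : ℝ) + 1)) ≤ 1 / 4 := by
  have hπ := Real.pi_pos
  have hQ : 0 ≤ l1Norm q := l1Norm_nonneg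
  refine ⟨8 * l1Norm q + C * Real.pi, ?_⟩
  set D := 8 * l1Norm q + C * Real.pi with hD
  obtain ⟨N, hN⟩ := exists_nat_ge (4 * C + 8 * l1Norm q + 4 + 4 * D)
  filter_upwards [Filter.eventually_ge_atTop N] with n hn
  have hnN : (N : ℝ) ≤ n := by exact_mod_cast hn
  have hD0 : 0 ≤ D := by positivity
  have hn1 : (0 : ℝ) < (n : ℝ) + 1 := by positivity
  have hrn := hr n
  have hC1 : C / ((n : ℝ) + 1) ≤ 1 / 4 := by
    rw [div_le_iff₀ hn1]; nlinarith
  have hrlow : ((n : ℝ) + 1) / 4 ≤ r n := by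
    have := (abs_le.1 hrn).1
    have := ha n
    nlinarith
  have hr0 : 0 < r n := by linarith
  obtain ⟨h1, h2⟩ := SPi_asymptotics hq hr0 (by nlinarith)
  have hQr : 2 * l1Norm q / r n ≤ 8 * l1Norm q * (1 / ((n : ℝ) + 1)) := by
    rw [mul_one_div, div_le_div_iff₀ hr0 hn1]
    nlinarith
  have hdist : |r n - a n| * Real.pi ≤ C * Real.pi * (1 / ((n : ℝ) + 1)) := by
    have := mul_le_mul_of_nonneg_right hrn hπ.le
    calc _ ≤ _ := this
      _ = _ := by ring
  have hang : |r n * Real.pi - a n * Real.pi| = |r n - a n| * Real.pi := by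
    rw [← sub_mul, abs_mul, abs_of_pos hπ]
  have hs := Real.abs_sin_sub_sin_le (r n * Real.pi) (a n * Real.pi)
  have hc := Real.abs_cos_sub_cos_le (r n * Real.pi) (a n * Real.pi)
  have hsum : D * (1 / ((n : ℝ) + 1)) =
      8 * l1Norm q * (1 / ((n : ℝ) + 1)) + C * Real.pi * (1 / ((n : ℝ) + 1)) := by
    rw [hD]; ring
  have hpos : 0 ≤ 8 * l1Norm q * (1 / ((n : ℝ) + 1)) := by positivity
  refine ⟨?_, ?_, by linarith, ?_⟩
  · have := abs_sub_le (r n * SPi q (r n ^ 2)) (Real.sin (r n * Real.pi))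
      (Real.sin (a n * Real.pi))
    linarith
  · have := abs_sub_le (dSPi q (r n ^ 2)) (Real.cos (r n * Real.pi))
      (Real.cos (a n * Real.pi))
    linarith
  · rw [mul_one_div, div_le_iff₀ hn1]
    linarith

theorem abs_sin_mul_sub_sin_mul_le {r a t : ℝ} (ht : t ∈ Set.Icc 0 Real.pi) :
    |Real.sin (r * t) - Real.sin (a * t)| ≤ |r - a| * Real.pi := by
  refine (Real.abs_sin_sub_sin_le _ _).trans ?_
  rw [← sub_mul, abs_mul, abs_of_nonneg ht.1]
  exact mul_le_mul_of_nonneg_left ht.2 (abs_nonneg _)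

theorem abs_cos_mul_sub_cos_mul_le {r a t : ℝ} (ht : t ∈ Set.Icc 0 Real.pi) :
    |Real.cos (r * t) - Real.cos (a * t)| ≤ |r - a| * Real.pi := by
  refine (Real.abs_cos_sub_cos_le _ _).trans ?_
  rw [← sub_mul, abs_mul, abs_of_nonneg ht.1]
  exact mul_le_mul_of_nonneg_left ht.2 (abs_nonneg _)

/-- The multiple `√(π/2)` of the orthonormal basis has components of amplitude one. -/
theorem sqrt_pi_div_two_mul_sqrt : √(Real.pi / 2) * √(2 / Real.pi) = 1 := by
  have hπ := Real.pi_pos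
  rw [← Real.sqrt_mul (by positivity)]
  field_simp
  simp

/-- The vectors with first component `sin ρt`, `ρ ≈ n + 1/2`, are quadratically close to the first
half of the trigonometric basis. -/
theorem summable_sub_sine (hq : IntervalIntegrable q volume 0 Real.pi) {r b : ℕ → ℝ} {C : ℝ}
    (hC : 0 ≤ C) (hr : ∀ n : ℕ, |r n - ((n : ℝ) + 1 / 2)| ≤ C / (n + 1))
    (hb : ∀ n, b n = -(dSPi q (r n ^ 2) / (r n * SPi q (r n ^ 2)))) :
    Summable fun n => ‖vec (sinFun 1 (r n)) (cosFun (b n) (r n)) -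
      √(Real.pi / 2) • trigVec (Sum.inl n)‖ ^ 2 := by
  obtain ⟨D, hD⟩ := eventually_close hq (a := fun n => (n : ℝ) + 1 / 2) hC hr
    fun n => by linarith [(Nat.cast_nonneg n : (0 : ℝ) ≤ n)]
  refine summable_of_eventually_le_div_sq (fun n => sq_nonneg _)
    (K := Real.pi * (D ^ 2 + (4 * D) ^ 2)) (hD.mono fun n hn => ?_)
  obtain ⟨h1, h2, h3, h4⟩ := hn
  set δ := D * (1 / ((n : ℝ) + 1)) with hδ
  have hc0 : Real.cos (((n : ℝ) + 1 / 2) * Real.pi) = 0 := by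
    have : ((n : ℝ) + 1 / 2) * Real.pi = n * Real.pi + Real.pi / 2 := by ring
    rw [this, Real.cos_add_pi_div_two, Real.sin_nat_mul_pi, neg_zero]
  have hb4 : |b n| ≤ 4 * δ := by
    rw [hb, abs_neg]
    refine abs_div_le_of_close (Real.sin_sq_add_cos_sq _) h2 h1 ?_ h4
    rw [hc0, abs_zero]
    exact (abs_nonneg _).trans h1
  have e : Real.pi * (D ^ 2 + (4 * D) ^ 2) * (1 / ((n : ℝ) + 1)) ^ 2 =
      Real.pi * (δ ^ 2 + (4 * δ) ^ 2) := by rw [hδ]; ring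
  rw [e, trigVec, vec_sub_smul_vec]
  refine norm_vec_sq_le (fun t ht => ?_) (fun t ht => ?_)
  · have : (sinFun 1 (r n) - √(Real.pi / 2) • sinFun √(2 / Real.pi) ((n : ℝ) + 1 / 2)) t =
        Real.sin (r n * t) - Real.sin (((n : ℝ) + 1 / 2) * t) := by
      simp only [sinFun, ContinuousMap.sub_apply, ContinuousMap.smul_apply, ContinuousMap.coe_mk,
        smul_eq_mul, one_mul]
      rw [← mul_assoc, sqrt_pi_div_two_mul_sqrt, one_mul]
    rw [this]
    exact (abs_sin_mul_sub_sin_mul_le ht).trans h3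
  · have : (cosFun (b n) (r n) - √(Real.pi / 2) • 0) t = b n * Real.cos (r n * t) := by
      simp [cosFun]
    rw [this, abs_mul]
    exact (mul_le_of_le_one_right (abs_nonneg _) (Real.abs_cos_le_one _)).trans hb4

/-- The vectors with second component `cos ρt`, `ρ ≈ n + 1`, are quadratically close to the second
half of the trigonometric basis without `[0, 1/√π]`. -/
theorem summable_sub_cosine (hq : IntervalIntegrable q volume 0 Real.pi) {r b : ℕ → ℝ} {C : ℝ}
    (hC : 0 ≤ C) (hr : ∀ n : ℕ, |r n - ((n : ℝ) + 1)| ≤ C / (n + 1))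
    (hb : ∀ n, b n = -(r n * SPi q (r n ^ 2) / dSPi q (r n ^ 2))) :
    Summable fun n => ‖vec (sinFun (b n) (r n)) (cosFun 1 (r n)) -
      √(Real.pi / 2) • trigVec (Sum.inr (n + 1))‖ ^ 2 := by
  obtain ⟨D, hD⟩ := eventually_close hq (a := fun n => (n : ℝ) + 1) hC hr
    fun n => by linarith [(Nat.cast_nonneg n : (0 : ℝ) ≤ n)]
  refine summable_of_eventually_le_div_sq (fun n => sq_nonneg _)
    (K := Real.pi * ((4 * D) ^ 2 + D ^ 2)) (hD.mono fun n hn => ?_)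
  obtain ⟨h1, h2, h3, h4⟩ := hn
  set δ := D * (1 / ((n : ℝ) + 1)) with hδ
  have hs0 : Real.sin (((n : ℝ) + 1) * Real.pi) = 0 := by
    exact_mod_cast Real.sin_nat_mul_pi (n + 1)
  have hb4 : |b n| ≤ 4 * δ := by
    rw [hb, abs_neg]
    refine abs_div_le_of_close (Real.cos_sq_add_sin_sq _) h1 h2 ?_ h4
    rw [hs0, abs_zero]
    exact (abs_nonneg _).trans h1
  have e : Real.pi * ((4 * D) ^ 2 + D ^ 2) * (1 / ((n : ℝ) + 1)) ^ 2 =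
      Real.pi * ((4 * δ) ^ 2 + δ ^ 2) := by rw [hδ]; ring
  rw [e, trigVec, vec_sub_smul_vec, if_neg n.succ_ne_zero]
  refine norm_vec_sq_le (fun t ht => ?_) (fun t ht => ?_)
  · have : (sinFun (b n) (r n) - √(Real.pi / 2) • 0) t = b n * Real.sin (r n * t) := by
      simp [sinFun]
    rw [this, abs_mul]
    exact (mul_le_of_le_one_right (abs_nonneg _) (Real.abs_sin_le_one _)).trans hb4
  · have : (cosFun 1 (r n) - √(Real.pi / 2) • cosFun √(2 / Real.pi) ((n + 1 : ℕ) : ℝ)) t =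
        Real.cos (r n * t) - Real.cos (((n : ℝ) + 1) * t) := by
      simp only [cosFun, ContinuousMap.sub_apply, ContinuousMap.smul_apply, ContinuousMap.coe_mk,
        smul_eq_mul, one_mul]
      rw [← mul_assoc, sqrt_pi_div_two_mul_sqrt, one_mul]
      push_cast
      rfl
    rw [this]
    exact (abs_cos_mul_sub_cos_mul_le ht).trans h3

end Closeness

/-! ### Completeness -/

section Completeness

theorem cosT_ofReal (f : ℝ → ℝ) (r : ℝ) :
    cosT f r = ((∫ t in (0 : ℝ)..Real.pi, Real.cos (r * t) * f t : ℝ) : ℂ) := by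
  rw [cosT, ← intervalIntegral.integral_ofReal]
  refine intervalIntegral.integral_congr fun t _ => ?_
  push_cast
  ring

theorem sinT_ofReal (f : ℝ → ℝ) (r : ℝ) :
    sinT f r = ((∫ t in (0 : ℝ)..Real.pi, Real.sin (r * t) * f t : ℝ) : ℂ) := by
  rw [sinT, ← intervalIntegral.integral_ofReal]
  refine intervalIntegral.integral_congr fun t _ => ?_
  push_cast
  ring

theorem inner_trig (x : H) (a b r : ℝ) : inner ℝ (vec (sinFun a r) (cosFun b r)) x =
    a * (∫ t in (0 : ℝ)..Real.pi, Real.sin (r * t) * x.fst t) +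
      b * ∫ t in (0 : ℝ)..Real.pi, Real.cos (r * t) * x.snd t := by
  simp only [inner_vec, sinFun, cosFun, ContinuousMap.coe_mk, mul_assoc,
    intervalIntegral.integral_const_mul]

variable {q : ℝ → ℝ}

/-- Completeness in terms of the function `h(ρ) = S ρ ∫ f₁ sin ρt - S' ∫ f₂ cos ρt`: it is even,
entire and `O(exp (2π |Im ρ|))`, so infinitely many zeros `r n ≈ (n + 1) / 2` and a zero at the
origin are too many for it unless it vanishes identically. -/
theorem eq_zero_of_transform_zeros (hq : IntervalIntegrable q volume 0 Real.pi)
    (hd0 : dSPi q 0 ≠ 0) {x : H} {r : ℕ → ℝ} (hr : ∀ n, 0 < r n) (hinj : Function.Injective r)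
    {C : ℝ} (hC : ∀ n : ℕ, r n ≤ (n + 1) / 2 + C / (n + 1))
    (h0 : ∫ t in (0 : ℝ)..Real.pi, x.snd t = 0)
    (hz : ∀ n, SPi q (r n ^ 2) * (r n * ∫ t in (0 : ℝ)..Real.pi, Real.sin (r n * t) * x.fst t) =
      dSPi q (r n ^ 2) * ∫ t in (0 : ℝ)..Real.pi, Real.cos (r n * t) * x.snd t) : x = 0 := by
  have hf₁ := intervalIntegrable_Lp x.fst
  have hf₂ := intervalIntegrable_Lp x.snd
  have hcos0 : cosT x.snd 0 = 0 := by
    have := cosT_ofReal x.snd 0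
    simpa [h0] using this
  have hzero := eq_zero_of_zeros
    (h := fun ρ : ℂ => sC hq (ρ ^ 2) * (ρ * sinT x.fst ρ) - dsC hq (ρ ^ 2) * cosT x.snd ρ)
    (B := 2 * l1Norm x.fst + 2 * l1Norm x.snd) (R₀ := 2 * l1Norm q + 1)
    (r := r) (C := C) ?_ ?_ ?_ ?_ hr hinj ?_ hC
  · have hT := transforms_eq_zero hq (by
      rw [← Complex.ofReal_zero, (sC_ofReal hq 0).2]; exact_mod_cast hd0) hf₁ hf₂
      fun ρ => sub_eq_zero.1 (hzero ρ)
    refine H_eq_zero (ae_eq_zero_of_integral_sin_eq_zero hf₁ fun n => ?_)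
      (ae_eq_zero_of_integral_cos_eq_zero hf₂ fun n => ?_)
    · have h1 := (hT ((n + 1 / 2 : ℝ) : ℂ)).1
      rw [sinT_ofReal, mul_eq_zero, Complex.ofReal_eq_zero, Complex.ofReal_eq_zero] at h1
      exact h1.resolve_left (by positivity)
    · have h1 := (hT ((n : ℝ) : ℂ)).2
      rw [cosT_ofReal] at h1
      exact_mod_cast h1
  · exact (((differentiable_sC hq).comp (by fun_prop)).mul
      (differentiable_id.mul (differentiable_sinT hf₁))).sub
      (((differentiable_dsC hq).comp (by fun_prop)).mul (differentiable_cosT hf₂))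
  · intro z
    simp only [neg_sq, sinT_neg, cosT_neg, neg_mul_neg]
  · intro ρ hρ
    obtain ⟨h1, h2⟩ := norm_sC_le hq hρ
    have h3 := norm_sinT_le hf₁ ρ
    have h4 := norm_cosT_le hf₂ ρ
    have e : Real.exp (2 * Real.pi * |ρ.im|) =
        Real.exp (|ρ.im| * Real.pi) * Real.exp (|ρ.im| * Real.pi) := by
      rw [← Real.exp_add]; congr 1; ring
    have e1 : sC hq (ρ ^ 2) * (ρ * sinT x.fst ρ) = ρ * sC hq (ρ ^ 2) * sinT x.fst ρ := by ring
    have := mul_le_mul h1 h3 (norm_nonneg _) (by positivity)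
    have := mul_le_mul h2 h4 (norm_nonneg _) (by positivity)
    rw [e, e1]
    refine (norm_sub_le _ _).trans ?_
    rw [norm_mul _ (sinT _ _), norm_mul _ (cosT _ _)]
    linarith
  · simp [hcos0]
  · intro n
    rw [← Complex.ofReal_pow, (sC_ofReal hq _).1, (sC_ofReal hq _).2, sinT_ofReal, cosT_ofReal]
    exact sub_eq_zero.2 (by exact_mod_cast hz n)

end Completeness

/-! ### The Riesz basis property -/

section Assembly

theorem intervalIntegrable_of_memLp {f : ℝ → ℝ} (hf : MemLp f 2 μ) :
    IntervalIntegrable f volume 0 Real.pi :=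
  (intervalIntegrable_iff_integrableOn_Ioo_of_le Real.pi_pos.le).2 (hf.integrable (by norm_num))

/-- The Riesz basis property for two sequences of positive numbers `r₁ n ≈ n + 1/2` and
`r₂ n ≈ n + 1` when the numbers `g_{nk}` are replaced by the quotients `-S'(π, ρ²) / S(π, ρ²)`. -/
theorem isRieszBasis_of_quotients {q : ℝ → ℝ} (hq : IntervalIntegrable q volume 0 Real.pi)
    (hd0 : dSPi q 0 ≠ 0) {r₁ r₂ : ℕ → ℝ} {C₁ C₂ : ℝ} (hC₁ : 0 ≤ C₁) (hC₂ : 0 ≤ C₂)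
    (hr₁ : ∀ n : ℕ, |r₁ n - ((n : ℝ) + 1 / 2)| ≤ C₁ / (n + 1))
    (hr₂ : ∀ n : ℕ, |r₂ n - ((n : ℝ) + 1)| ≤ C₂ / (n + 1))
    (hpos₁ : ∀ n, 0 < r₁ n) (hpos₂ : ∀ n, 0 < r₂ n)
    (hinj₁ : Function.Injective r₁) (hinj₂ : Function.Injective r₂) (hne : ∀ i j, r₁ i ≠ r₂ j)
    (hS : ∀ n, SPi q (r₁ n ^ 2) ≠ 0) (hdS : ∀ n, dSPi q (r₂ n ^ 2) ≠ 0) {v : ℕ ⊕ ℕ → H}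
    (hv₁ : ∀ n, v (Sum.inl n) = vec (sinFun 1 (r₁ n))
      (cosFun (-(dSPi q (r₁ n ^ 2) / (r₁ n * SPi q (r₁ n ^ 2)))) (r₁ n)))
    (hv₀ : v (Sum.inr 0) = vec (ContinuousMap.const ℝ 0) (ContinuousMap.const ℝ 1))
    (hv₂ : ∀ n, v (Sum.inr (n + 1)) =
      vec (sinFun (-(r₂ n * SPi q (r₂ n ^ 2) / dSPi q (r₂ n ^ 2))) (r₂ n)) (cosFun 1 (r₂ n))) :
    IsRieszBasis v := by
  have hπ := Real.pi_pos
  refine isRieszBasis_of_quadratically_close trigBasis v (c := √(Real.pi / 2)) (by positivity)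
    ?_ fun x hx => ?_
  · refine Summable.sum _ ?_ ((summable_nat_add_iff 1).1 ?_)
    · refine (summable_sub_sine hq hC₁ hr₁ fun n => rfl).congr fun n => ?_
      rw [Function.comp_apply, hv₁, trigBasis_apply]
    · refine (summable_sub_cosine hq hC₂ hr₂ fun n => rfl).congr fun n => ?_
      rw [Function.comp_apply, hv₂, trigBasis_apply]
  · -- the zeros in increasing order of their main terms `(n + 1) / 2`
    let r : ℕ → ℝ := fun n => if n % 2 = 0 then r₁ (n / 2) else r₂ (n / 2)
    have hdiv : ∀ n : ℕ, (n : ℝ) = 2 * (n / 2 : ℕ) + (n % 2 : ℕ) := fun n => by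
      exact_mod_cast (Nat.div_add_mod n 2).symm
    refine eq_zero_of_transform_zeros hq hd0 (r := r) (C := 2 * (C₁ + C₂)) (fun n => ?_)
      (fun i j hij => ?_) (fun n => ?_) ?_ (fun n => ?_)
    · simp only [r]
      split_ifs
      exacts [hpos₁ _, hpos₂ _]
    · simp only [r] at hij
      split_ifs at hij with h1 h2 h2
      · have := hinj₁ hij; omega
      · exact absurd hij (hne _ _)
      · exact absurd hij.symm (hne _ _)
      · have := hinj₂ hij; omega
    · have hk : (0 : ℝ) < ((n / 2 : ℕ) : ℝ) + 1 := by positivity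
      have hC : ∀ c : ℝ, 0 ≤ c → c ≤ C₁ + C₂ →
          c / (((n / 2 : ℕ) : ℝ) + 1) ≤ 2 * (C₁ + C₂) / ((n : ℝ) + 1) := by
        intro c hc hc'
        rw [div_le_div_iff₀ hk (by positivity)]
        have h1 : (n : ℝ) + 1 ≤ 2 * (((n / 2 : ℕ) : ℝ) + 1) := by
          have : n + 1 ≤ 2 * (n / 2 + 1) := by omega
          exact_mod_cast this
        nlinarith
      have hn := hdiv n
      simp only [r]
      split_ifs with h
      · have h1 := (abs_le.1 (hr₁ (n / 2))).2
        have h2 := hC C₁ hC₁ (by linarith)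
        rw [h, Nat.cast_zero] at hn
        linarith
      · have h1 := (abs_le.1 (hr₂ (n / 2))).2
        have h2 := hC C₂ hC₂ (by linarith)
        rw [Nat.mod_two_ne_zero.1 h, Nat.cast_one] at hn
        linarith
    · have := hx (Sum.inr 0)
      rw [hv₀, inner_vec] at this
      simpa using this
    · simp only [r]
      split_ifs
      · have h1 := hx (Sum.inl (n / 2))
        rw [hv₁, inner_trig] at h1
        have hS' := hS (n / 2)
        have hp := (hpos₁ (n / 2)).ne'
        field_simp at h1
        linear_combination h1
      · have h1 := hx (Sum.inr (n / 2 + 1))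
        rw [hv₂, inner_trig] at h1
        have hdS' := hdS (n / 2)
        field_simp at h1
        linear_combination -h1

end Assembly

end StarGraph

theorem lemma3 (m : ℕ) (hm : 2 ≤ m) (q : ℕ → ℝ → ℝ)
    (hq : ∀ j ∈ Finset.Icc 1 m, MemLp (q j) 2 (volume.restrict (Set.Ioo 0 Real.pi)))
    (lam : ℕ → ℕ → ℝ) (z₁ : ℝ)
    -- `λ_{n1}`, `λ_{n2}` (`n ≥ 1`) are eigenvalues of `L` with the standard asymptotics
    (heig : ∀ n : ℕ, 1 ≤ n → ∀ k ∈ Finset.Icc 1 2, StarGraph.IsEigenvalue m q (lam n k))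
    (hz₁ : (StarGraph.charPoly m q).IsRoot z₁)
    (hasymp₁ : StarGraph.HasAsymptotics (fun n => Real.sqrt (lam n 1))
      (fun n => (n : ℝ) - 1 / 2) (StarGraph.omegaHat m q))
    (hasymp₂ : StarGraph.HasAsymptotics (fun n => Real.sqrt (lam n 2))
      (fun n => (n : ℝ)) z₁)
    -- the eigenvalues are distinct and positive; `S_j(π, λ_{nk}) ≠ 0`; `z₁ ≠ ω_j`;
    -- `S_1(π, 0) ≠ 0`, `S_1'(π, 0) ≠ 0`
    (h_i : Set.InjOn (fun p : ℕ × ℕ => lam p.1 p.2) {p | 1 ≤ p.1 ∧ p.2 ∈ Finset.Icc 1 2})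
    (h_ii : ∀ n : ℕ, 1 ≤ n → ∀ k ∈ Finset.Icc 1 2, 0 < lam n k)
    (h_iii : ∀ j ∈ Finset.Icc 1 m, ∀ n : ℕ, 1 ≤ n → ∀ k ∈ Finset.Icc 1 2,
      StarGraph.SPi (q j) (lam n k) ≠ 0)
    (h_iv : ∀ j ∈ Finset.Icc 1 m, z₁ ≠ StarGraph.omega (q j))
    (h_v : StarGraph.SPi (q 1) 0 ≠ 0 ∧ StarGraph.dSPi (q 1) 0 ≠ 0)
    -- the denominators in `v_{n2}` do not vanish
    (hg : ∀ n : ℕ, 1 ≤ n → StarGraph.g m q (lam n 2) ≠ 0) :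
    StarGraph.IsRieszBasis
      (Sum.elim (StarGraph.v₁ m q lam) (StarGraph.v₂ m q lam) : ℕ ⊕ ℕ → StarGraph.H) := by
  have hq' : ∀ j ∈ Finset.Icc 1 m, IntervalIntegrable (q j) volume 0 Real.pi := fun j hj =>
    StarGraph.intervalIntegrable_of_memLp (hq j hj)
  have h1 : (1 : ℕ) ∈ Finset.Icc 1 2 := by simp
  have h2 : (2 : ℕ) ∈ Finset.Icc 1 2 := by simp
  have h1m : 1 ∈ Finset.Icc 1 m := Finset.mem_Icc.2 ⟨le_rfl, by omega⟩
  have hgS : ∀ n : ℕ, 1 ≤ n → ∀ k ∈ Finset.Icc 1 2, StarGraph.g m q (lam n k) =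
      -(StarGraph.dSPi (q 1) (lam n k) / StarGraph.SPi (q 1) (lam n k)) := fun n hn k hk =>
    StarGraph.g_eq_of_isEigenvalue (by omega) hq' (heig n hn k hk) fun j hj => h_iii j hj n hn k hk
  have hsq : ∀ n : ℕ, 1 ≤ n → ∀ k ∈ Finset.Icc 1 2, √(lam n k) ^ 2 = lam n k := fun n hn k hk =>
    Real.sq_sqrt (h_ii n hn k hk).le
  have hinj : ∀ n k n' k' : ℕ, 1 ≤ n → k ∈ Finset.Icc 1 2 → 1 ≤ n' → k' ∈ Finset.Icc 1 2 →
      √(lam n k) = √(lam n' k') → n = n' ∧ k = k' := by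
    intro n k n' k' hn hk hn' hk' h
    have e : lam n k = lam n' k' := by rw [← hsq n hn k hk, ← hsq n' hn' k' hk', h]
    have := h_i (show (n, k) ∈ {p : ℕ × ℕ | 1 ≤ p.1 ∧ p.2 ∈ Finset.Icc 1 2} from ⟨hn, hk⟩)
      (show (n', k') ∈ {p : ℕ × ℕ | 1 ≤ p.1 ∧ p.2 ∈ Finset.Icc 1 2} from ⟨hn', hk'⟩) e
    exact ⟨congrArg Prod.fst this, congrArg Prod.snd this⟩
  obtain ⟨C₁, hC₁, hb₁⟩ := hasymp₁.exists_abs_sub_le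
  obtain ⟨C₂, hC₂, hb₂⟩ := hasymp₂.exists_abs_sub_le
  refine StarGraph.isRieszBasis_of_quotients (hq' 1 h1m) h_v.2
    (r₁ := fun n => √(lam (n + 1) 1)) (r₂ := fun n => √(lam (n + 1) 2)) hC₁ hC₂
    (fun n => ?_) (fun n => ?_)
    (fun n => Real.sqrt_pos.2 (h_ii _ (by omega) 1 h1))
    (fun n => Real.sqrt_pos.2 (h_ii _ (by omega) 2 h2))
    (fun i j h => by have := (hinj _ _ _ _ (by omega) h1 (by omega) h1 h).1; omega)
    (fun i j h => by have := (hinj _ _ _ _ (by omega) h2 (by omega) h2 h).1; omega)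
    (fun i j h => by have := (hinj _ _ _ _ (by omega) h1 (by omega) h2 h).2; omega)
    (fun n => ?_) (fun n h => ?_) (fun n => ?_) ?_ (fun n => ?_)
  · refine le_trans (le_of_eq ?_) (hb₁ n)
    push_cast
    congr 1
    ring
  · refine le_trans (le_of_eq ?_) (hb₂ n)
    push_cast
    rfl
  · simpa only [hsq (n + 1) (by omega) 1 h1] using h_iii 1 h1m (n + 1) (by omega) 1 h1
  · -- `g_{n2} ≠ 0` means `S'(π, λ_{n2}) ≠ 0`
    rw [hsq (n + 1) (by omega) 2 h2] at h
    refine hg (n + 1) (by omega) ?_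
    rw [hgS (n + 1) (by omega) 2 h2, h, zero_div, neg_zero]
  · simp only [Sum.elim_inl, StarGraph.v₁, hsq (n + 1) (by omega) 1 h1,
      hgS (n + 1) (by omega) 1 h1]
    congr 2
    rw [neg_div, div_div, mul_comm]
  · simp only [Sum.elim_inr, StarGraph.v₂, if_true]
  · simp only [Sum.elim_inr, StarGraph.v₂, hsq (n + 1) (by omega) 2 h2,
      hgS (n + 1) (by omega) 2 h2, if_neg n.succ_ne_zero]
    congr 2
    rw [div_neg, div_div_eq_mul_div]
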